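/- Let $G$ be a compact connected Lie group with identity $e$, normalized Haar measure $\mu$ and a bi-invariant Riemannian metric. Let $\mathrm{Irr}(G)$ be the set of equivalence classes of irreducible (continuous, complex) representations of $G$, and for each $\delta\in\mathrm{Irr}(G)$ fix a unitary matrix representation $U^\delta$ in the class $\delta$; let $d_\delta$ be its dimension, $\delta_0$ the class of the unit representation, and $\lambda_\delta$ the real number such that the matrix elements of $U^\delta$ are eigenfunctions of the Laplace–Beltrami operator with eigenvalue $-\lambda_\delta$. For a $G$-valued random variable $X$ put $\phi_X(\delta)=\mathbb E[U^\delta(X)]$. Let $\lambda>0$, $T>0$ and $\sigma\in\mathbb R$. Let $N=(N(t))_{t\ge0}$ be a Poisson process with parameter $\lambda$, and let $(X_n)_{n\ge1}$ be i.i.d. $G$-valued random variables, independent of $N$, with a common probability density $p\in L^2(G,\mathbb R)$ with respect to $\mu$, and such that $X_1$ and $X_1^{-1}$ have the same distribution. Let $Y(t)=X_1X_2\cdots X_{N(t)}$ (the empty product being $e$), let $M$ be a $G$-valued random variable independent of the process $Y$ with $\phi_M(\delta)=e^{-\lambda_\delta\sigma^2/2}I_{d_\delta}$ for all $\delta\in\mathrm{Irr}(G)$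 (Brownian noise), and let $(Z_n)_{n\ge1}$ be i.i.d. with the distribution of $Z=M\,Y(T)$. For $n\ge1$ and $\delta\in\mathrm{Irr}(G)$ put $$\hat\phi^n_Z(\delta)=\frac1{2n}\sum_{m=1}^n\bigl(U^\delta(Z_m)+U^\delta(Z_m)^\dagger\bigr),\qquad R^n_\delta=\{\text{the spectrum of }\hat\phi^n_Z(\delta)\text{ is contained in }]0,\infty[\},$$ and, with $\bar\lambda_\delta=\lambda+\lambda_\delta\sigma^2/(2T)$, let $$\hat\phi^n_X(\delta)=\frac1{T\lambda}\,\mathrm{Log}\bigl[\hat\phi^n_Z(\delta)\bigr]+\frac{\bar\lambda_\delta}{\lambda}I_{d_\delta}\ \text{ on } R^n_\delta,\qquad \hat\phi^n_X(\delta)=0\ \text{ outside } R^n_\delta,$$ where $\mathrm{Log}$ is the Hermitian logarithm of a Hermitian positive definite matrix. Let $(\Gamma_l)_{l\ge1}$ be an increasing sequence of finite subsets of $\mathrm{Irr}(G)$ with $\bigcup_l\Gamma_l=\mathrm{Irr}(G)\setminus\{\delta_0\}$. For $K\ge0$ the nonparametric estimates of $p$ are $$\hat p^n_l(g)=1+\sum_{\delta\in\Gamma_l}d_\delta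 e^{-K\lambda_\delta}\,\mathrm{tr}\bigl(\hat\phi^n_X(\delta)\,U^\delta(g)^\dagger\bigr),\qquad g\in G.$$ Take $K=0$. Then $\hat p^n_l\in L^2(G,\mathbb C)$, and, with $\|\cdot\|$ the norm of $L^2(G,\mathbb C)$, $$\lim_l\lim_n\|\hat p^n_l-p\|=0$$ in probability; that is, there are constants $c_l\ge0$ such that for each $l$ the random variables $\|\hat p^n_l-p\|$ converge to $c_l$ in probability as $n\to\infty$, and $c_l\to0$ as $l\to\infty$. -/

import Mathlib

open MeasureTheory ProbabilityTheory Filter Topology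
open scoped NNReal Manifold ContDiff Matrix

noncomputable section

namespace Decompounding

/-! ### Irreducible unitary representations and the set `Irr G` -/

section Representations

variable (G : Type*) [Group G] [TopologicalSpace G]

/-- A continuous irreducible unitary matrix representation of `G`. -/
structure UnitaryIrrep where
  /-- the dimension of the representation -/
  dim : ℕ
  /-- the homomorphism into the unitary group -/
  hom : G →* Matrix.unitaryGroup (Fin dim) ℂ
  continuous_hom : Continuous hom
  irreducible : Representation.IsIrreducible
    ((Matrix.toLinAlgEquiv' : Matrix (Fin dim) (Fin dim) ℂ ≃ₐ[ℂ] _).toMonoidHom.comp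
      ((Matrix.unitaryGroup (Fin dim) ℂ).subtype.comp hom) :
        Representation ℂ G (Fin dim → ℂ))

variable {G}

/-- The unitary matrix `U(g)`. -/
def UnitaryIrrep.mat (U : UnitaryIrrep G) (g : G) : Matrix (Fin U.dim) (Fin U.dim) ℂ :=
  (U.hom g : Matrix (Fin U.dim) (Fin U.dim) ℂ)

/-- The representation of `G` on `ℂ ^ dim` given by the matrices `U(g)`. -/
def UnitaryIrrep.rep (U : UnitaryIrrep G) : Representation ℂ G (Fin U.dim → ℂ) :=
  (Matrix.toLinAlgEquiv' : Matrix (Fin U.dim) (Fin U.dim) ℂ ≃ₐ[ℂ] _).toMonoidHom.comp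
    ((Matrix.unitaryGroup (Fin U.dim) ℂ).subtype.comp U.hom)

variable (G)

/-- Equivalence of representations. -/
instance UnitaryIrrep.setoid : Setoid (UnitaryIrrep G) where
  r U V := Nonempty (U.rep.Equiv V.rep)
  iseqv :=
    ⟨fun U => ⟨Representation.Equiv.refl U.rep⟩, fun ⟨e⟩ => ⟨e.symm⟩, fun ⟨e⟩ ⟨f⟩ => ⟨e.trans f⟩⟩

/-- `Irr G`: the equivalence classes of irreducible representations. On a compact group every
irreducible representation on a Hilbert space is finite dimensional and equivalent to a unitary
one, hence to a unitary matrix representation. -/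
def Irr : Type _ := Quotient (UnitaryIrrep.setoid G)

/-- The unit representation: dimension one, `U(g) = 1` for all `g`. -/
def UnitaryIrrep.unit : UnitaryIrrep G where
  dim := 1
  hom := 1
  continuous_hom := continuous_const
  irreducible := by
    have key : ∀ W : Submodule ℂ (Fin 1 → ℂ), W = ⊥ ∨ W = ⊤ := by
      have : IsSimpleOrder (Submodule ℂ (Fin 1 → ℂ)) :=
        (isSimpleModule_iff _ _).1 (isSimpleModule_iff_finrank_eq_one.2 (by simp))
      exact fun W => eq_bot_or_eq_top W
    refine @IsSimpleOrder.mk _ _ _ ⟨⊥, ⊤, fun h => ?_⟩ fun W => ?_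
    · have h' := congrArg Subrepresentation.toSubmodule h
      exact bot_ne_top (α := Submodule ℂ (Fin 1 → ℂ)) h'
    · rcases key W.toSubmodule with h | h
      · exact Or.inl (Subrepresentation.toSubmodule_injective h)
      · exact Or.inr (Subrepresentation.toSubmodule_injective h)

/-- The class `δ₀` of the unit representation. -/
def Irr.unit : Irr G := Quotient.mk (UnitaryIrrep.setoid G) (UnitaryIrrep.unit G)

variable {G}

/-- The characteristic function of a `G`-valued random variable `X`, at the irreducible
representation `U`: the matrix `𝔼[U(X)]`, entry by entry. -/
def charMatrix {Ω : Type*} [MeasurableSpace Ω] (P : Measure Ω) (X : Ω → G) (U : UnitaryIrrep G) :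
    Matrix (Fin U.dim) (Fin U.dim) ℂ :=
  Matrix.of fun i j => ∫ w, U.mat (X w) i j ∂P

end Representations

/-! ### The Laplace-Beltrami operator of a bi-invariant metric -/

section Laplacian

variable {E : Type*} [NormedAddCommGroup E] [NormedSpace ℝ E] [FiniteDimensional ℝ E]
  {G : Type*} [TopologicalSpace G] [ChartedSpace E G] [Group G] [LieGroup 𝓘(ℝ, E) ∞ G]

/-- A smooth Riemannian metric on the Lie group `G`. -/
abbrev Metric (E : Type*) [NormedAddCommGroup E] [NormedSpace ℝ E]
    (G : Type*) [TopologicalSpace G] [ChartedSpace E G] [Group G] [LieGroup 𝓘(ℝ, E) ∞ G] :=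
  haveI : IsManifold 𝓘(ℝ, E) 1 G := IsManifold.of_le (n := ∞) (by simp)
  Bundle.ContMDiffRiemannianMetric 𝓘(ℝ, E) ∞ E (fun g : G => TangentSpace 𝓘(ℝ, E) g)

/-- All left and all right translations are isometries. -/
structure Metric.IsBiinvariant (m : Metric E G) : Prop where
  left : ∀ (h g : G) (v u : TangentSpace 𝓘(ℝ, E) g),
    m.inner (h * g) (mfderiv 𝓘(ℝ, E) 𝓘(ℝ, E) (fun x : G => h * x) g v)
      (mfderiv 𝓘(ℝ, E) 𝓘(ℝ, E) (fun x : G => h * x) g u) = m.inner g v u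
  right : ∀ (h g : G) (v u : TangentSpace 𝓘(ℝ, E) g),
    m.inner (g * h) (mfderiv 𝓘(ℝ, E) 𝓘(ℝ, E) (fun x : G => x * h) g v)
      (mfderiv 𝓘(ℝ, E) 𝓘(ℝ, E) (fun x : G => x * h) g u) = m.inner g v u

/-- The derivative of `f` along the left invariant vector field with value `v` at the identity. -/
def leftDeriv (v : GroupLieAlgebra 𝓘(ℝ, E) G) (f : G → ℂ) (g : G) : ℂ :=
  mfderiv 𝓘(ℝ, E) 𝓘(ℝ, ℂ) f g (mulInvariantVectorField v g)

/-- The Gram matrix at the identity of a basis of the Lie algebra. -/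
def Metric.gram (m : Metric E G) :
    Matrix (Fin (Module.finrank ℝ E)) (Fin (Module.finrank ℝ E)) ℝ :=
  Matrix.of fun i j => m.inner (1 : G) (Module.finBasis ℝ E i) (Module.finBasis ℝ E j)

/-- The Laplace-Beltrami operator of a bi-invariant metric: `∑ a b, gᵃᵇ X_a X_b`, where `X_a` are
the left invariant fields of a basis of the Lie algebra and `gᵃᵇ` is the inverse Gram matrix (so
`∑ a, X_a X_a` for an orthonormal basis). The Lie algebra is the tangent space at the identity,
whose underlying vector space is `E`. -/
def Metric.laplacian (m : Metric E G) (f : G → ℂ) (g : G) : ℂ :=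
  ∑ a, ∑ b, ((m.gram⁻¹ a b : ℝ) : ℂ) *
    leftDeriv (G := G) (Module.finBasis ℝ E a)
      (leftDeriv (G := G) (Module.finBasis ℝ E b) f) g

/-- `- c` is the eigenvalue of the Laplace-Beltrami operator on the matrix elements of `U`. -/
def Metric.IsEigenvalue (m : Metric E G) (U : UnitaryIrrep G) (c : ℝ) : Prop :=
  ∀ (i j : Fin U.dim) (g : G), m.laplacian (fun x => U.mat x i j) g = -(c : ℂ) * U.mat g i j

/-- `λ_δ`: the (unique) real number such that the matrix elements of the representation are
eigenfunctions of the Laplace-Beltrami operator for the eigenvalue `-λ_δ`. -/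
def Metric.eigenvalue (m : Metric E G) (U : UnitaryIrrep G) : ℝ :=
  Classical.epsilon fun c : ℝ => m.IsEigenvalue U c

/-- The law of `M` is that at time `σ²` of a standard Brownian motion on `G` started at the
identity: its characteristic function is `δ ↦ exp(- λ_δ σ² / 2) I`. -/
def IsBrownianNoise (m : Metric E G) (σ : ℝ) {Ω : Type*} [MeasurableSpace Ω] (P : Measure Ω)
    (M : Ω → G) : Prop :=
  ∀ U : UnitaryIrrep G, charMatrix P M U = (Real.exp (-(m.eigenvalue U * σ ^ 2 / 2)) : ℂ) • 1

end Laplacian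

/-! ### Compound Poisson processes -/

/-- `N` is a Poisson process with parameter `lam`. -/
structure IsPoissonProcess {Ω : Type*} [MeasurableSpace Ω] (P : Measure Ω) (lam : ℝ≥0)
    (N : ℝ≥0 → Ω → ℕ) : Prop where
  measurable : ∀ t, Measurable (N t)
  zero : ∀ᵐ w ∂P, N 0 w = 0
  monotone : ∀ᵐ w ∂P, Monotone fun t => N t w
  right_continuous : ∀ᵐ w ∂P, ∀ t, ContinuousWithinAt (fun s => N s w) (Set.Ici t) t
  indep_increments : HasIndepIncrements N P
  law_increments : ∀ s t, s ≤ t →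
    P.map (fun w => N t w - N s w) = poissonMeasure (lam * (t - s))

/-- The left compound Poisson process `Y(t) = X₁ X₂ ⋯ X_{N(t)}`; the empty product is the
identity. The random variable `X_{n+1}` is `X n`. -/
def compoundPoisson {G Ω : Type*} [Group G] (N : ℝ≥0 → Ω → ℕ) (X : ℕ → Ω → G) (t : ℝ≥0) (w : Ω) :
    G :=
  (List.ofFn fun i : Fin (N t w) => X i w).prod

/-! ### The estimators -/

section Estimators

variable {E : Type*} [NormedAddCommGroup E] [NormedSpace ℝ E] [FiniteDimensional ℝ E]
  {G : Type*} [TopologicalSpace G] [ChartedSpace E G] [Group G] [LieGroup 𝓘(ℝ, E) ∞ G]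
  {Ω : Type*}

/-- The empirical estimate `(1 / 2n) ∑_{k = 1}^n (U(Z_k) + U(Z_k)†)`; here `Z_{k+1}` is `Z k`. -/
def empiricalChar (Z : ℕ → Ω → G) (U : UnitaryIrrep G) (n : ℕ) (w : Ω) :
    Matrix (Fin U.dim) (Fin U.dim) ℂ :=
  (1 / (2 * n) : ℂ) • ∑ k ∈ Finset.range n, (U.mat (Z k w) + (U.mat (Z k w))ᴴ)

/-- The event that the spectrum of the empirical estimate lies in `]0, ∞[`. -/
def positiveEvent (Z : ℕ → Ω → G) (U : UnitaryIrrep G) (n : ℕ) : Set Ω :=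
  {w | spectrum ℂ (empiricalChar Z U n w) ⊆ (fun x : ℝ => (x : ℂ)) '' Set.Ioi 0}

/-- The constant `λ + λ_δ σ² / (2 T)` of the compounding transformation
`φ_Z(δ) = exp(T λ φ_X(δ) - T (λ + λ_δ σ² / (2 T)) I)`. -/
def lambdaBar (m : Metric E G) (T lam : ℝ≥0) (σ : ℝ) (U : UnitaryIrrep G) : ℝ :=
  lam + m.eigenvalue U * σ ^ 2 / (2 * T)

open Classical in
/-- The parametric estimate of `φ_X(δ)`. The Hermitian logarithm of a positive definite Hermitian
matrix is given by the functional calculus. -/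
def paramEstimate (m : Metric E G) (T lam : ℝ≥0) (σ : ℝ) (Z : ℕ → Ω → G) (U : UnitaryIrrep G)
    (n : ℕ) (w : Ω) : Matrix (Fin U.dim) (Fin U.dim) ℂ :=
  if w ∈ positiveEvent Z U n then
    (1 / (T * lam) : ℂ) • cfc Real.log (empiricalChar Z U n w) +
      ((lambdaBar m T lam σ U / lam : ℝ) : ℂ) • (1 : Matrix (Fin U.dim) (Fin U.dim) ℂ)
  else 0

/-- The nonparametric estimate
`1 + ∑_{δ ∈ Γ} d_δ exp(-K λ_δ) tr(φ̂ⁿ_X(δ) U^δ(g)†)`, where `U` is a choice of representatives. -/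
def nonparamEstimate (m : Metric E G) (T lam : ℝ≥0) (σ K : ℝ) (U : Irr G → UnitaryIrrep G)
    (Γ : Finset (Irr G)) (Z : ℕ → Ω → G) (n : ℕ) (w : Ω) (g : G) : ℂ :=
  1 + ∑ δ ∈ Γ, ((U δ).dim * Real.exp (-(K * m.eigenvalue (U δ))) : ℂ) *
    (paramEstimate m T lam σ Z (U δ) n w * ((U δ).mat g)ᴴ).trace

end Estimators

end Decompounding

end

/-! # Nonparametric decompounding on a compact Lie group

Let `φ_Z(δ)` and `φ_X(δ)` be the characteristic functions of the observations `Z = M Y(T)` and of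
the jumps. Characteristic functions are multiplicative on independent products
(`charMatrix_mul`), and conditioning on the number of jumps sums the exponential series
(`charMatrix_compoundPoisson`), so that
`φ_Z(δ) = exp (T λ φ_X(δ) - T (λ + λ_δ σ² / (2 T)) I)` (`charMatrix_noise_mul_compoundPoisson`).
Inverse invariance makes `φ_X(δ)` Hermitian (`isHermitian_charMatrix`); hence `φ_Z(δ)` is positive
definite, its logarithm returns the exponent (`logEstimate_exp`), and `λ_δ` cancels.

By the strong law of large numbers, the averages of `U^δ(Z_k)` converge to `φ_Z(δ)`
(`tendstoInMeasure_empiricalMean`). The estimate of `φ_X(δ)` is a fixed function of this average,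
which takes the Hermitian part, tests positivity of the spectrum, and takes the logarithm. It is
continuous at the limit (`continuousAt_logEstimate_hermitianPart`), because positivity of the
spectrum is an open condition on Hermitian matrices. So, for fixed `l`, the `L²` distance of the
estimate to `p` tends in probability to the distance `c_l` to `p` of the finite Fourier sum
`1 + ∑ δ ∈ Γ_l, d_δ tr (φ_X(δ) U^δ(·)†)` (`tendstoInMeasure_comp_of_continuousAt`).

The matrices `φ_X(δ)` are the Fourier coefficients of the density (`charMatrix_eq_inner`), and the
summand `1` is the term of the unit representation. Therefore `c_l → 0` by the Peter–Weyl theorem,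
which is proved in the form needed here. The normalized matrix elements are orthonormal by Schur's
lemma (`orthonormal_coeffVector`). They are total (`topologicalClosure_coeffSpan`): convolution with
a continuous Hermitian kernel is a compact symmetric operator on `L²`, whose eigenspaces for nonzero
eigenvalues are finite dimensional and translation invariant, hence spanned by matrix elements
(`eigenspace_convolutionL2_le`). By the spectral theorem a function orthogonal to all matrix
elements is annihilated by all these operators, and so it is orthogonal to every continuous
function. -/

namespace Decompounding

/-! ### Matrix elements and Schur's lemma -/

section Schur

variable {G : Type*} [Group G] [TopologicalSpace G]

namespace UnitaryIrrep

variable (U V : UnitaryIrrep G)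

lemma mat_one : U.mat 1 = 1 := by simp [mat]

lemma mat_mul (g h : G) : U.mat (g * h) = U.mat g * U.mat h := by simp [mat]

lemma mat_conjTranspose_mul (g : G) : (U.mat g)ᴴ * U.mat g = 1 :=
  Matrix.mem_unitaryGroup_iff'.1 (U.hom g).2

lemma mat_inv (g : G) : U.mat g⁻¹ = (U.mat g)ᴴ := by
  have h : U.mat g * U.mat g⁻¹ = 1 := by rw [← U.mat_mul, mul_inv_cancel, U.mat_one]
  rw [← one_mul (U.mat g⁻¹), ← U.mat_conjTranspose_mul g, mul_assoc, h, mul_one]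

lemma mat_inv_apply (g : G) (i j : Fin U.dim) : U.mat g⁻¹ i j = star (U.mat g j i) := by
  rw [U.mat_inv, Matrix.conjTranspose_apply]

lemma continuous_mat : Continuous U.mat := continuous_subtype_val.comp U.continuous_hom

lemma continuous_mat_apply (i j : Fin U.dim) : Continuous fun g => U.mat g i j :=
  U.continuous_mat.matrix_elem i j

lemma norm_mat_apply_le (g : G) (i j : Fin U.dim) : ‖U.mat g i j‖ ≤ 1 :=
  entry_norm_bound_of_unitary (U.hom g).2 i j

lemma rep_apply (g : G) (v : Fin U.dim → ℂ) : U.rep g v = U.mat g *ᵥ v := rfl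

instance isIrreducible_rep : U.rep.IsIrreducible := U.irreducible

lemma dim_pos : 0 < U.dim := by
  by_contra h
  have h0 : IsEmpty (Fin U.dim) := by
    rw [Nat.pos_iff_ne_zero, not_not] at h
    rw [h]; infer_instance
  have : (⊥ : Subrepresentation U.rep) = ⊤ := by
    apply Subrepresentation.toSubmodule_injective
    exact Subsingleton.elim _ _
  exact bot_ne_top this

variable {U V}

/-- The intertwining map given by a matrix that intertwines two matrix representations. -/
def intertwiner (A : Matrix (Fin V.dim) (Fin U.dim) ℂ)
    (hA : ∀ g, A * U.mat g = V.mat g * A) : U.rep.IntertwiningMap V.rep :=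
  LinearMap.intertwiningMap_of_isIntertwiningMap U.rep V.rep (Matrix.toLin' A) fun g v => by
    rw [rep_apply, rep_apply, Matrix.toLin'_apply, Matrix.toLin'_apply, Matrix.mulVec_mulVec,
      Matrix.mulVec_mulVec, hA]

lemma intertwiner_apply (A : Matrix (Fin V.dim) (Fin U.dim) ℂ)
    (hA : ∀ g, A * U.mat g = V.mat g * A) (v : Fin U.dim → ℂ) :
    intertwiner A hA v = A *ᵥ v := rfl

/-- **Schur's lemma**: a matrix intertwining two inequivalent representations vanishes. -/
lemma eq_zero_of_intertwines (h : ¬ U ≈ V) (A : Matrix (Fin V.dim) (Fin U.dim) ℂ)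
    (hA : ∀ g, A * U.mat g = V.mat g * A) : A = 0 := by
  rcases Representation.IsIrreducible.bijective_or_eq_zero (intertwiner A hA) with hb | h0
  · exact absurd ⟨(intertwiner A hA).ofBijective hb⟩ h
  · ext i j
    have h1 := congrArg (fun f : U.rep.IntertwiningMap V.rep => f (Pi.single j 1) i) h0
    simpa [intertwiner_apply] using h1

/-- **Schur's lemma**: a matrix commuting with an irreducible representation is scalar. -/
lemma eq_trace_smul_of_commutes (A : Matrix (Fin U.dim) (Fin U.dim) ℂ)
    (hA : ∀ g, A * U.mat g = U.mat g * A) : A = (A.trace / U.dim) • 1 := by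
  obtain ⟨c, hc⟩ :=
    (Representation.IsIrreducible.algebraMap_intertwiningMap_bijective_of_isAlgClosed
    (k := ℂ) (ρ := U.rep)).2 (intertwiner A hA)
  have h1 : A = c • 1 := by
    ext i j
    have h1 := congrArg (fun f : U.rep.IntertwiningMap U.rep => f (Pi.single j 1) i) hc
    simp only [intertwiner_apply, Matrix.mulVec_single_one] at h1
    rw [Matrix.col_apply] at h1
    rw [← h1, Algebra.algebraMap_eq_smul_one]
    change c • (Pi.single j (1 : ℂ) : Fin U.dim → ℂ) i = _
    simp [Matrix.one_apply, Pi.single_apply]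
  have hd : (U.dim : ℂ) ≠ 0 := by exact_mod_cast U.dim_pos.ne'
  have h2 : A.trace = c * U.dim := by rw [h1]; simp
  rw [h2, mul_div_cancel_right₀ _ hd, ← h1]

/-- Equivalent matrix representations are conjugate. -/
lemma exists_conj_of_equiv (h : U ≈ V) : ∃ (A : Matrix (Fin V.dim) (Fin U.dim) ℂ)
    (B : Matrix (Fin U.dim) (Fin V.dim) ℂ), ∀ g, V.mat g = A * U.mat g * B := by
  obtain ⟨e⟩ := h
  refine ⟨LinearMap.toMatrix' e.toLinearEquiv.toLinearMap,
    LinearMap.toMatrix' e.toLinearEquiv.symm.toLinearMap, fun g => ?_⟩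
  apply Matrix.toLin'.injective
  refine LinearMap.ext fun v => ?_
  have h1 : e (U.rep g (e.toLinearEquiv.symm v)) = V.rep g (e (e.toLinearEquiv.symm v)) :=
    e.toIntertwiningMap.isIntertwining _ _ g _
  have h2 : e (e.toLinearEquiv.symm v) = v := e.toLinearEquiv.apply_symm_apply v
  rw [h2] at h1
  rw [Matrix.toLin'_mul, Matrix.toLin'_mul, Matrix.toLin'_toMatrix', Matrix.toLin'_toMatrix']
  exact h1.symm

lemma mat_eq_one_of_equiv_unit (h : unit G ≈ U) (g : G) : U.mat g = 1 := by
  obtain ⟨A, B, hAB⟩ := exists_conj_of_equiv h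
  have h1 : ∀ x, (unit G).mat x = 1 := fun _ => rfl
  rw [← U.mat_one, hAB, hAB, h1, h1]

lemma dim_eq_one_of_equiv_unit (h : unit G ≈ U) : U.dim = 1 := by
  obtain ⟨e⟩ := h
  simpa [unit] using (LinearEquiv.finrank_eq e.toLinearEquiv).symm.trans
    (Module.finrank_fin_fun ℂ)

end UnitaryIrrep

end Schur

/-! ### Schur orthogonality -/

section Orthogonality

variable {G : Type*} [Group G] [TopologicalSpace G] [IsTopologicalGroup G] [CompactSpace G]
  [MeasurableSpace G] [BorelSpace G] (μ : Measure G) [μ.IsHaarMeasure]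

namespace UnitaryIrrep

variable (U V : UnitaryIrrep G)

omit [IsTopologicalGroup G] in
lemma integrable_mat_mul_star_mat (i j : Fin U.dim) (k l : Fin V.dim) :
    Integrable (fun g => U.mat g i j * star (V.mat g k l)) μ :=
  ((U.continuous_mat_apply i j).mul (V.continuous_mat_apply k l).star)
    |>.integrable_of_hasCompactSupport
    (HasCompactSupport.of_compactSpace _)

/-- For fixed `j` and `l`, the matrix `∫ U(g) E_{jl} V(g)†`. -/
noncomputable def averagedMatrix (j : Fin U.dim) (l : Fin V.dim) :
    Matrix (Fin U.dim) (Fin V.dim) ℂ :=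
  Matrix.of fun i k => ∫ g, U.mat g i j * star (V.mat g k l) ∂μ

lemma averagedMatrix_intertwines (j : Fin U.dim) (l : Fin V.dim) (h : G) :
    averagedMatrix μ U V j l * V.mat h = U.mat h * averagedMatrix μ U V j l := by
  ext i k
  simp only [Matrix.mul_apply, averagedMatrix, Matrix.of_apply]
  calc ∑ a, (∫ g, U.mat g i j * star (V.mat g a l) ∂μ) * V.mat h a k
      = ∫ g, U.mat g i j * star (V.mat (h⁻¹ * g) k l) ∂μ := by
        simp_rw [V.mat_mul, Matrix.mul_apply, star_sum, Finset.mul_sum, V.mat_inv_apply, star_mul',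
          star_star]
        rw [integral_finsetSum]
        · refine Finset.sum_congr rfl fun a _ => ?_
          rw [← integral_mul_const]
          refine integral_congr_ae (.of_forall fun g => ?_)
          simp only; ring
        · intro a _
          refine ((integrable_mat_mul_star_mat μ U V i j a l).mul_const (V.mat h a k)).congr
            (.of_forall fun g => ?_)
          simp only; ring
    _ = ∫ g, U.mat (h * g) i j * star (V.mat g k l) ∂μ := by
        rw [← integral_mul_left_eq_self _ h]
        simp
    _ = ∑ a, U.mat h i a * ∫ g, U.mat g a j * star (V.mat g k l) ∂μ := by
        simp_rw [U.mat_mul, Matrix.mul_apply, Finset.sum_mul]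
        rw [integral_finsetSum]
        · refine Finset.sum_congr rfl fun a _ => ?_
          rw [← integral_const_mul]
          refine integral_congr_ae (.of_forall fun g => ?_)
          simp only; ring
        · intro a _
          refine ((integrable_mat_mul_star_mat μ U V a j k l).const_mul (U.mat h i a)).congr
            (.of_forall fun g => ?_)
          simp only; ring

variable {U V} in
/-- **Schur orthogonality** for inequivalent representations. -/
lemma integral_mat_mul_star_mat_of_not_equiv (h : ¬ V ≈ U) (i j : Fin U.dim) (k l : Fin V.dim) :
    ∫ g, U.mat g i j * star (V.mat g k l) ∂μ = 0 := by
  have h1 := eq_zero_of_intertwines h (averagedMatrix μ U V j l)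
    (averagedMatrix_intertwines μ U V j l)
  exact congrFun (congrFun h1 i) k

/-- **Schur orthogonality** for the matrix elements of one representation. -/
lemma integral_mat_mul_star_mat_self [IsProbabilityMeasure μ] (i j k l : Fin U.dim) :
    ∫ g, U.mat g i j * star (U.mat g k l) ∂μ = if i = k ∧ j = l then (U.dim : ℂ)⁻¹ else 0 := by
  have h1 := eq_trace_smul_of_commutes (averagedMatrix μ U U j l)
    (averagedMatrix_intertwines μ U U j l)
  have h2 : (averagedMatrix μ U U j l).trace = if j = l then 1 else 0 := by
    simp only [Matrix.trace, Matrix.diag, averagedMatrix, Matrix.of_apply]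
    rw [← integral_finsetSum _ fun a _ => integrable_mat_mul_star_mat μ U U a j a l]
    have h3 : ∀ g, ∑ a, U.mat g a j * star (U.mat g a l) = if j = l then 1 else 0 := fun g => by
      have h4 := congrFun (congrFun (U.mat_conjTranspose_mul g) l) j
      rw [Matrix.mul_apply, Matrix.one_apply] at h4
      simp only [Matrix.conjTranspose_apply] at h4
      rw [← ite_congr (propext eq_comm) (fun _ => rfl) (fun _ => rfl)]
      rw [← h4]
      exact Finset.sum_congr rfl fun a _ => mul_comm _ _
    simp_rw [h3]
    simp
  have h5 := congrFun (congrFun h1 i) k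
  rw [h2] at h5
  simp only [averagedMatrix, Matrix.of_apply, Matrix.smul_apply, Matrix.one_apply,
    smul_eq_mul] at h5
  rw [h5]
  by_cases hi : i = k <;> by_cases hj : j = l <;> simp [hi, hj]

end UnitaryIrrep

end Orthogonality

/-! ### Finite dimensional invariant subspaces of a unitary representation -/

section Invariant

variable {G : Type*} [Group G] [TopologicalSpace G]
  {H : Type*} [NormedAddCommGroup H] [InnerProductSpace ℂ H]

/-- The vectors `b j` transform under `ρ` by the matrices `U(g)`. -/
def TransformsBy (ρ : Representation ℂ G H) (U : UnitaryIrrep G) (b : Fin U.dim → H) : Prop :=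
  ∀ g j, ρ g (b j) = ∑ i, U.mat g i j • b i

variable {ρ : Representation ℂ G H}

/-- The matrices of a unitary representation in an orthonormal basis of a minimal invariant
subspace form an irreducible unitary matrix representation. -/
lemma exists_transformsBy_of_minimal
    (hiso : ∀ g x y, inner ℂ (ρ g x) (ρ g y) = inner ℂ x y)
    (hcont : ∀ x, Continuous fun g => ρ g x)
    (V : Submodule ℂ H) [FiniteDimensional ℂ V] (hV : ∀ g, ∀ x ∈ V, ρ g x ∈ V) (hne : V ≠ ⊥)
    (hmin : ∀ S ≤ V, (∀ g, ∀ x ∈ S, ρ g x ∈ S) → S = ⊥ ∨ S = V) :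
    ∃ (U : UnitaryIrrep G) (b : Fin U.dim → H),
      TransformsBy ρ U b ∧ Submodule.span ℂ (Set.range b) = V := by
  obtain ⟨n, ⟨b⟩⟩ : ∃ n, Nonempty (OrthonormalBasis (Fin n) ℂ V) :=
    ⟨_, ⟨stdOrthonormalBasis ℂ V⟩⟩
  let A : G → Matrix (Fin n) (Fin n) ℂ :=
    fun g => Matrix.of fun i j => inner ℂ (b i : H) (ρ g (b j))
  have hA : ∀ g j, ρ g (b j) = ∑ i, A g i j • (b i : H) := fun g j => by
    have h := b.sum_repr' ⟨ρ g (b j), hV g _ (b j).2⟩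
    have h' := congrArg Subtype.val h
    simp only [Submodule.coe_sum, Submodule.coe_smul, Submodule.coe_inner] at h'
    exact h'.symm
  have hmul : ∀ g h, A (g * h) = A g * A h := fun g h => by
    ext i j
    simp only [A, Matrix.of_apply, Matrix.mul_apply, map_mul, Module.End.mul_apply]
    conv_lhs => rw [hA h j, map_sum, inner_sum]
    refine Finset.sum_congr rfl fun k _ => ?_
    rw [map_smul, inner_smul_right, mul_comm]
    rfl
  have hone : A 1 = 1 := by
    ext i j
    simp only [A, Matrix.of_apply, map_one, Module.End.one_apply, Matrix.one_apply]
    rw [← Submodule.coe_inner]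
    exact orthonormal_iff_ite.1 b.orthonormal i j
  have hinv : ∀ g, A g⁻¹ = star (A g) := fun g => by
    ext i j
    simp only [A, Matrix.of_apply, Matrix.star_apply]
    rw [← hiso g, ← Module.End.mul_apply, ← map_mul, mul_inv_cancel, map_one,
      Module.End.one_apply]
    exact (inner_conj_symm _ _).symm
  have hu : ∀ g, A g ∈ Matrix.unitaryGroup (Fin n) ℂ := fun g => by
    rw [Matrix.mem_unitaryGroup_iff, ← hinv, ← hmul, mul_inv_cancel, hone]
  let hom : G →* Matrix.unitaryGroup (Fin n) ℂ :=
    { toFun := fun g => ⟨A g, hu g⟩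
      map_one' := Subtype.ext hone
      map_mul' := fun g h => Subtype.ext (hmul g h) }
  have hc : Continuous hom := by
    refine Continuous.subtype_mk (continuous_matrix fun i j => ?_) _
    exact continuous_const.inner (hcont _)
  let e : (Fin n → ℂ) →ₗ[ℂ] H := Fintype.linearCombination ℂ fun i => (b i : H)
  have he : ∀ x, e x = ∑ i, x i • (b i : H) := fun x => Fintype.linearCombination_apply _ _ _
  have hli : LinearIndependent ℂ fun i => (b i : H) :=
    b.orthonormal.linearIndependent.map' V.subtype V.ker_subtype
  have hinj : Function.Injective e := hli.fintypeLinearCombination_injective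
  have hrange : LinearMap.range e = V := by
    rw [Fintype.range_linearCombination]
    have h1 := congrArg (Submodule.map V.subtype) b.toBasis.span_eq
    rw [Submodule.map_span, Submodule.map_top, Submodule.range_subtype, ← Set.range_comp] at h1
    refine Eq.trans ?_ h1
    congr 2
  have hequiv : ∀ g x, e (A g *ᵥ x) = ρ g (e x) := fun g x => by
    simp only [he, map_sum, map_smul, hA, Finset.smul_sum, Matrix.mulVec, dotProduct,
      Finset.sum_smul, smul_smul]
    rw [Finset.sum_comm]
    simp_rw [mul_comm]
  refine ⟨⟨n, hom, hc, ?_⟩, fun i => b i, hA, ?_⟩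
  · refine @IsSimpleOrder.mk _ _ _ ⟨⊥, ⊤, fun h => hne ?_⟩ fun W => ?_
    · have h' : (⊥ : Submodule ℂ (Fin n → ℂ)) = ⊤ :=
        congrArg Subrepresentation.toSubmodule h
      rw [← hrange, LinearMap.range_eq_map, ← h', Submodule.map_bot]
    · have hS := hmin (W.toSubmodule.map e) (by rw [← hrange]; exact LinearMap.map_le_range)
        (by
          rintro g _ ⟨x, hx, rfl⟩
          exact ⟨A g *ᵥ x, W.apply_mem_toSubmodule g hx, hequiv g x⟩)
      rcases hS with h | h
      · left
        apply Subrepresentation.toSubmodule_injective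
        exact Submodule.map_injective_of_injective hinj (h.trans (Submodule.map_bot e).symm)
      · right
        apply Subrepresentation.toSubmodule_injective
        apply Submodule.map_injective_of_injective hinj
        rw [h, ← hrange, LinearMap.range_eq_map]
        rfl
  · exact (Fintype.range_linearCombination ℂ _).symm.trans hrange

/-- Complete reducibility: a finite dimensional invariant subspace of a unitary representation is
spanned by tuples of its elements that transform by irreducible unitary matrix representations. -/
lemma le_span_transformsBy
    (hiso : ∀ g x y, inner ℂ (ρ g x) (ρ g y) = inner ℂ x y)
    (hcont : ∀ x, Continuous fun g => ρ g x)
    (V : Submodule ℂ H) [FiniteDimensional ℂ V] (hV : ∀ g, ∀ x ∈ V, ρ g x ∈ V) :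
    V ≤ Submodule.span ℂ {x | ∃ (U : UnitaryIrrep G) (b : Fin U.dim → H) (j : Fin U.dim),
      TransformsBy ρ U b ∧ (∀ i, b i ∈ V) ∧ x = b j} := by
  induction hn : Module.finrank ℂ V using Nat.strong_induction_on generalizing V with
  | _ n ih =>
  by_cases hne : V = ⊥
  · rw [hne]; exact bot_le
  by_cases hmin : ∀ S ≤ V, (∀ g, ∀ x ∈ S, ρ g x ∈ S) → S = ⊥ ∨ S = V
  · obtain ⟨U, b, hb, hspan⟩ := exists_transformsBy_of_minimal hiso hcont V hV hne hmin
    conv_lhs => rw [← hspan]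
    refine Submodule.span_mono ?_
    rintro _ ⟨j, rfl⟩
    exact ⟨U, b, j, hb, fun i => hspan ▸ Submodule.subset_span ⟨i, rfl⟩, rfl⟩
  push Not at hmin
  obtain ⟨S, hSV, hS, hS0, hS1⟩ := hmin
  have : FiniteDimensional ℂ S := Submodule.finiteDimensional_of_le hSV
  have hRV : Sᗮ ⊓ V ≤ V := inf_le_right
  have : FiniteDimensional ℂ (Sᗮ ⊓ V : Submodule ℂ H) := Submodule.finiteDimensional_of_le hRV
  have hR : ∀ g, ∀ x ∈ Sᗮ ⊓ V, ρ g x ∈ Sᗮ ⊓ V := fun g x hx => by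
    refine ⟨(Submodule.mem_orthogonal _ _).2 fun u hu => ?_, hV g x hx.2⟩
    rw [← hiso g⁻¹, ← Module.End.mul_apply (ρ g⁻¹), ← map_mul, inv_mul_cancel, map_one]
    exact (Submodule.mem_orthogonal _ _).1 hx.1 _ (hS _ _ hu)
  have hsup : S ⊔ Sᗮ ⊓ V = V := Submodule.sup_orthogonal_inf_of_hasOrthogonalProjection hSV
  have hR1 : Sᗮ ⊓ V ≠ V := fun h => hS0 <| by
    have h1 : S ≤ Sᗮ := hSV.trans (h ▸ inf_le_left)
    exact le_bot_iff.1 (S.inf_orthogonal_eq_bot ▸ le_inf le_rfl h1)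
  have key : ∀ R : Submodule ℂ H, R ≤ V → R ≠ V → (∀ g, ∀ x ∈ R, ρ g x ∈ R) →
      R ≤ Submodule.span ℂ {x | ∃ (U : UnitaryIrrep G) (b : Fin U.dim → H) (j : Fin U.dim),
        TransformsBy ρ U b ∧ (∀ i, b i ∈ V) ∧ x = b j} := fun R hRV hne hR => by
    have : FiniteDimensional ℂ R := Submodule.finiteDimensional_of_le hRV
    refine (ih _ (hn ▸ Submodule.finrank_lt_finrank_of_lt (lt_of_le_of_ne hRV hne)) R hR
      rfl).trans (Submodule.span_mono ?_)
    rintro x ⟨U, b, j, hb, hbR, rfl⟩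
    exact ⟨U, b, j, hb, fun i => hRV (hbR i), rfl⟩
  conv_lhs => rw [← hsup]
  exact sup_le (key S hSV hS1 hS) (key _ hRV hR1 hR)

end Invariant

/-! ### Integral operators with continuous kernels -/

section Kernel

variable {X : Type*} [TopologicalSpace X] [CompactSpace X]
  {H : Type*} [NormedAddCommGroup H] [InnerProductSpace ℂ H]

/-- The operator `f ↦ (x ↦ ⟪F x, f⟫)` from `H` to `C(X, ℂ)` of a continuous family `F` of vectors
of `H`. -/
noncomputable def innerOperator (F : C(X, H)) : H →L[ℂ] C(X, ℂ) :=
  LinearMap.mkContinuous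
    { toFun := fun f => ⟨fun x => inner ℂ (F x) f, F.continuous.inner continuous_const⟩
      map_add' := fun f g => by ext x; simp
      map_smul' := fun c f => by ext x; simp }
    ‖F‖ fun f => by
      refine (ContinuousMap.norm_le _ (by positivity)).2 fun x => ?_
      exact (norm_inner_le_norm _ _).trans
        (mul_le_mul_of_nonneg_right (F.norm_coe_le_norm x) (norm_nonneg f))

/-- By the Arzelà–Ascoli theorem, `innerOperator F` is a compact operator. -/
lemma isCompactOperator_innerOperator (F : C(X, H)) : IsCompactOperator (innerOperator F) := by
  let L := ContinuousMap.linearIsometryBoundedOfCompact X ℂ ℂ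
  let A := (fun f => L (innerOperator F f)) '' Metric.closedBall 0 1
  have hA : IsCompact (closure A) := by
    refine BoundedContinuousFunction.arzela_ascoli (Metric.closedBall 0 ‖F‖)
      (isCompact_closedBall _ _) A ?_ ?_
    · rintro _ x ⟨f, hf, rfl⟩
      rw [mem_closedBall_zero_iff] at hf ⊢
      refine (norm_inner_le_norm (F x) f).trans ?_
      exact (mul_le_of_le_one_right (norm_nonneg _) hf).trans (F.norm_coe_le_norm x)
    · intro x
      rw [Metric.equicontinuousAt_iff_right]
      intro ε hε
      filter_upwards [F.continuous.continuousAt.eventually (Metric.ball_mem_nhds (F x) hε)]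
      rintro y hy ⟨_, f, hf, rfl⟩
      rw [mem_closedBall_zero_iff] at hf
      rw [dist_comm, dist_eq_norm] at hy
      rw [dist_eq_norm]
      change ‖inner ℂ (F x) f - inner ℂ (F y) f‖ < ε
      rw [← inner_sub_left]
      exact (norm_inner_le_norm _ _).trans_lt
        ((mul_le_of_le_one_right (norm_nonneg _) hf).trans_lt hy)
  refine ⟨L.symm '' closure A, hA.image L.symm.continuous, ?_⟩
  filter_upwards [Metric.closedBall_mem_nhds (0 : H) one_pos] with f hf
  exact ⟨L (innerOperator F f), subset_closure ⟨f, hf, rfl⟩, L.symm_apply_apply _⟩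

end Kernel

/-! ### Conjugates of matrix elements -/

section StarCoeff

variable {G : Type*} [Group G] [TopologicalSpace G]

/-- The conjugate of a matrix element, as a continuous function. -/
def UnitaryIrrep.starCoeff (U : UnitaryIrrep G) (i j : Fin U.dim) : C(G, ℂ) :=
  ⟨fun g => star (U.mat g i j), (U.continuous_mat_apply i j).star⟩

lemma UnitaryIrrep.starCoeff_apply (U : UnitaryIrrep G) (i j : Fin U.dim) (g : G) :
    U.starCoeff i j g = star (U.mat g i j) := rfl

end StarCoeff

/-! ### Convolution operators on `L²` and the Peter–Weyl theorem -/

section Regular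

variable {G : Type*} [Group G] [TopologicalSpace G] [IsTopologicalGroup G] [CompactSpace G]
  [MeasurableSpace G] [BorelSpace G] (μ : Measure G) [μ.IsHaarMeasure]

/-- The left regular representation `f ↦ f (g⁻¹ ·)` on `L²`. -/
noncomputable def leftRegular : Representation ℂ G (Lp ℂ 2 μ) where
  toFun g := Lp.compMeasurePreservingₗ ℂ (g⁻¹ * ·) (measurePreserving_mul_left μ g⁻¹)
  map_one' := by
    refine LinearMap.ext fun f => Lp.ext ?_
    refine (Lp.coeFn_compMeasurePreserving f (measurePreserving_mul_left μ (1 : G)⁻¹)).trans ?_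
    exact .of_forall fun x => by simp
  map_mul' g h := by
    refine LinearMap.ext fun f => Lp.ext ?_
    have hf : ((h⁻¹ * ·) ∘ (g⁻¹ * ·) : G → G) = ((g * h)⁻¹ * ·) :=
      funext fun x => by simp [mul_assoc]
    have := Lp.compMeasurePreserving_comp_apply f (measurePreserving_mul_left μ h⁻¹)
      (measurePreserving_mul_left μ g⁻¹)
    simp only [hf] at this
    exact .of_forall fun x => congrArg (fun f : Lp ℂ 2 μ => f x) this

omit [CompactSpace G] in
lemma inner_leftRegular (g : G) (f h : Lp ℂ 2 μ) :
    inner ℂ (leftRegular μ g f) (leftRegular μ g h) = inner ℂ f h :=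
  (Lp.compMeasurePreservingₗᵢ ℂ (g⁻¹ * ·) (measurePreserving_mul_left μ g⁻¹)).inner_map_map f h

lemma continuous_leftRegular (f : Lp ℂ 2 μ) : Continuous fun g => leftRegular μ g f := by
  have hg : Continuous fun g : G => (ContinuousMap.mk fun x : G => g⁻¹ * x) :=
    ((ContinuousMap.mk fun p : G × G => p.1⁻¹ * p.2).curry).continuous
  exact (continuous_const (y := f)).compMeasurePreservingLp hg
    (fun g => measurePreserving_mul_left μ g⁻¹) (by simp)

lemma leftRegular_toLp (g : G) (φ : C(G, ℂ)) :
    leftRegular μ g (ContinuousMap.toLp 2 μ ℂ φ) =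
      ContinuousMap.toLp 2 μ ℂ (φ.comp ⟨fun x => g⁻¹ * x, continuous_const_mul _⟩) := rfl

/-- The operator `f ↦ (x ↦ ⟪k (x⁻¹ ·), f⟫)` from `L²` to continuous functions. -/
noncomputable def convolution (k : Lp ℂ 2 μ) : Lp ℂ 2 μ →L[ℂ] C(G, ℂ) :=
  innerOperator ⟨fun x => leftRegular μ x k, continuous_leftRegular μ k⟩

lemma convolution_apply (k f : Lp ℂ 2 μ) (x : G) :
    convolution μ k f x = inner ℂ (leftRegular μ x k) f := rfl

/-- Convolution as an operator on `L²`. -/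
noncomputable def convolutionL2 (k : Lp ℂ 2 μ) : Lp ℂ 2 μ →L[ℂ] Lp ℂ 2 μ :=
  (ContinuousMap.toLp 2 μ ℂ).comp (convolution μ k)

lemma convolutionL2_apply (k f : Lp ℂ 2 μ) :
    convolutionL2 μ k f = ContinuousMap.toLp 2 μ ℂ (convolution μ k f) := rfl

lemma isCompactOperator_convolutionL2 (k : Lp ℂ 2 μ) : IsCompactOperator (convolutionL2 μ k) :=
  (isCompactOperator_innerOperator _).clm_comp (ContinuousMap.toLp 2 μ ℂ)

lemma convolutionL2_leftRegular (k f : Lp ℂ 2 μ) (g : G) :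
    convolutionL2 μ k (leftRegular μ g f) = leftRegular μ g (convolutionL2 μ k f) := by
  rw [convolutionL2_apply, convolutionL2_apply, leftRegular_toLp]
  congr 1
  ext x
  change inner ℂ (leftRegular μ x k) (leftRegular μ g f) = inner ℂ (leftRegular μ (g⁻¹ * x) k) f
  rw [← inner_leftRegular μ g⁻¹, ← Module.End.mul_apply, ← Module.End.mul_apply, ← map_mul,
    ← map_mul, inv_mul_cancel, map_one, Module.End.one_apply]

lemma inner_leftRegular_toLp (k : C(G, ℂ)) (f : Lp ℂ 2 μ) (x : G) :
    inner ℂ (leftRegular μ x (ContinuousMap.toLp 2 μ ℂ k)) f =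
      ∫ y, star (k (x⁻¹ * y)) * f y ∂μ := by
  rw [leftRegular_toLp, L2.inner_def]
  refine integral_congr_ae ?_
  filter_upwards [ContinuousMap.coeFn_toLp (p := 2) (𝕜 := ℂ) μ
    (k.comp ⟨fun y => x⁻¹ * y, continuous_const_mul _⟩)] with y hy
  rw [hy, RCLike.inner_apply']
  rfl

variable {μ} in
/-- A tuple of continuous functions that transforms by `U` under left translations consists of
linear combinations of the conjugates of the matrix elements of `U`: evaluate the transformation
law at the identity. -/
lemma mem_span_of_transformsBy (U : UnitaryIrrep G) (φ : Fin U.dim → C(G, ℂ))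
    (h : TransformsBy (leftRegular μ) U fun j => ContinuousMap.toLp 2 μ ℂ (φ j))
    (j : Fin U.dim) :
    φ j ∈ Submodule.span ℂ (Set.range fun q : Fin U.dim × Fin U.dim => U.starCoeff q.1 q.2) := by
  have h1 : φ j = ∑ i, φ i 1 • U.starCoeff j i := by
    ext g
    have h2 := h g⁻¹ j
    simp only [leftRegular_toLp, ← map_smul, ← map_sum] at h2
    have h3 := DFunLike.congr_fun (ContinuousMap.toLp_injective μ h2) 1
    simp only [ContinuousMap.comp_apply, ContinuousMap.coe_mk, inv_inv, mul_one,
      ContinuousMap.coe_sum, ContinuousMap.coe_smul, Finset.sum_apply, Pi.smul_apply,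
      U.mat_inv_apply] at h3
    simp only [h3, ContinuousMap.coe_sum, ContinuousMap.coe_smul, Finset.sum_apply, Pi.smul_apply,
      smul_eq_mul, UnitaryIrrep.starCoeff_apply]
    exact Finset.sum_congr rfl fun i _ => mul_comm _ _
  rw [h1]
  exact Submodule.sum_mem _ fun i _ =>
    Submodule.smul_mem _ _ (Submodule.subset_span ⟨(j, i), rfl⟩)

/-- The span in `L²` of the conjugates of the matrix elements of all irreducible unitary matrix
representations. -/
noncomputable def coeffSpan : Submodule ℂ (Lp ℂ 2 μ) :=
  Submodule.span ℂ {f | ∃ (U : UnitaryIrrep G) (i j : Fin U.dim),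
    f = ContinuousMap.toLp 2 μ ℂ (U.starCoeff i j)}

/-- The eigenspaces of convolution operators for nonzero eigenvalues consist of linear combinations
of matrix elements: they are finite dimensional, invariant under left translations, and their
elements are continuous. -/
lemma eigenspace_convolutionL2_le (k : Lp ℂ 2 μ) (c : ℂ) (hc : c ≠ 0) :
    Module.End.eigenspace (convolutionL2 μ k).toLinearMap c ≤ coeffSpan μ := by
  have : FiniteDimensional ℂ (Module.End.eigenspace (convolutionL2 μ k).toLinearMap c) :=
    ContinuousLinearMap.finite_dimensional_eigenspace (isCompactOperator_convolutionL2 μ k) c hc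
  refine (le_span_transformsBy (ρ := leftRegular μ) (inner_leftRegular μ)
    (continuous_leftRegular μ) _ fun g f hf => ?_).trans (Submodule.span_le.2 ?_)
  · rw [Module.End.mem_eigenspace_iff] at hf ⊢
    change convolutionL2 μ k f = _ at hf
    change convolutionL2 μ k (leftRegular μ g f) = _
    rw [convolutionL2_leftRegular, hf, map_smul]
  · rintro _ ⟨U, b, j, hb, hbV, rfl⟩
    have hcont : ∀ i, b i = ContinuousMap.toLp 2 μ ℂ (c⁻¹ • convolution μ k (b i)) := fun i => by
      have h1 := Module.End.mem_eigenspace_iff.1 (hbV i)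
      change convolutionL2 μ k (b i) = _ at h1
      rw [map_smul, ← convolutionL2_apply, h1, smul_smul, inv_mul_cancel₀ hc, one_smul]
    have h2 := mem_span_of_transformsBy (μ := μ) U (fun i => c⁻¹ • convolution μ k (b i))
      (by simpa only [← hcont] using hb) j
    have h3 := Submodule.mem_map_of_mem
      (f := (ContinuousMap.toLp 2 μ ℂ : C(G, ℂ) →L[ℂ] Lp ℂ 2 μ).toLinearMap) h2
    rw [Submodule.map_span] at h3
    rw [hcont j]
    refine Submodule.span_mono ?_ h3
    rintro _ ⟨_, ⟨q, rfl⟩, rfl⟩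
    exact ⟨U, q.1, q.2, rfl⟩

variable [SecondCountableTopology G]

/-- Convolution with a Hermitian kernel is symmetric. -/
lemma isSymmetric_convolutionL2 (k : C(G, ℂ)) (hk : ∀ x, k x⁻¹ = star (k x)) :
    (convolutionL2 μ (ContinuousMap.toLp 2 μ ℂ k)).IsSymmetric := by
  intro f h
  have hf : Integrable f μ := (Lp.memLp f).integrable (by norm_num)
  have hh : Integrable h μ := (Lp.memLp h).integrable (by norm_num)
  have hint : Integrable (Function.uncurry fun x y => k (x⁻¹ * y) * (h x * star (f y)))
      (μ.prod μ) := by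
    have h1 : Integrable (fun p : G × G => h p.1 * star (f p.2)) (μ.prod μ) :=
      hh.mul_prod (g := fun y => star (f y))
        ((Complex.conjCLE : ℂ →L[ℝ] ℂ).integrable_comp hf)
    refine h1.bdd_mul (c := ‖k‖) ?_ (.of_forall fun p => k.norm_coe_le_norm _)
    exact (Continuous.aestronglyMeasurable (by fun_prop))
  have hL : inner ℂ (convolutionL2 μ (ContinuousMap.toLp 2 μ ℂ k) f) h =
      ∫ x, ∫ y, k (x⁻¹ * y) * (h x * star (f y)) ∂μ ∂μ := by
    rw [L2.inner_def]
    refine integral_congr_ae ?_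
    filter_upwards [ContinuousMap.coeFn_toLp (p := 2) (𝕜 := ℂ) μ
      (convolution μ (ContinuousMap.toLp 2 μ ℂ k) f)] with x hx
    rw [convolutionL2_apply, hx, RCLike.inner_apply', convolution_apply, inner_leftRegular_toLp,
      ← integral_conj, ← integral_mul_const]
    refine integral_congr_ae (.of_forall fun y => ?_)
    simp; ring
  have hR : inner ℂ f (convolutionL2 μ (ContinuousMap.toLp 2 μ ℂ k) h) =
      ∫ y, ∫ x, k (x⁻¹ * y) * (h x * star (f y)) ∂μ ∂μ := by
    rw [L2.inner_def]
    refine integral_congr_ae ?_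
    filter_upwards [ContinuousMap.coeFn_toLp (p := 2) (𝕜 := ℂ) μ
      (convolution μ (ContinuousMap.toLp 2 μ ℂ k) h)] with y hy
    rw [convolutionL2_apply, hy, RCLike.inner_apply', convolution_apply, inner_leftRegular_toLp,
      ← integral_const_mul]
    refine integral_congr_ae (.of_forall fun x => ?_)
    have : star (k (y⁻¹ * x)) = k (x⁻¹ * y) := by rw [← hk]; simp
    simp only [this]
    simp; ring
  exact (hL.trans (integral_integral_swap hint)).trans hR.symm

variable [T2Space G]

/-- The **Peter–Weyl theorem**: the matrix elements are total in `L²`. A function orthogonal to them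
is annihilated by all convolution operators with Hermitian continuous kernel, hence orthogonal to
all continuous functions. -/
theorem topologicalClosure_coeffSpan : (coeffSpan μ).topologicalClosure = ⊤ := by
  rw [Submodule.topologicalClosure_eq_top_iff, Submodule.eq_bot_iff]
  intro f hf
  have hherm : ∀ k : C(G, ℂ), (∀ x, k x⁻¹ = star (k x)) →
      inner ℂ (ContinuousMap.toLp 2 μ ℂ k) f = 0 := fun k hk => by
    set T := convolutionL2 μ (ContinuousMap.toLp 2 μ ℂ k) with hT
    have hsymm : T.IsSymmetric := isSymmetric_convolutionL2 μ k hk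
    have hTf : T f ∈ (⨆ c, Module.End.eigenspace T.toLinearMap c)ᗮ := by
      rw [← Submodule.iInf_orthogonal, Submodule.mem_iInf]
      intro c
      rw [Submodule.mem_orthogonal]
      intro v hv
      have h1 : T v = c • v := Module.End.mem_eigenspace_iff.1 hv
      have h2 : inner ℂ (T v) f = inner ℂ v (T f) := hsymm v f
      rw [← h2, h1, inner_smul_left]
      by_cases hc : c = 0
      · simp [hc]
      · rw [(Submodule.mem_orthogonal _ _).1 hf v (eigenspace_convolutionL2_le μ _ c hc hv),
          mul_zero]
    rw [ContinuousLinearMap.orthogonalComplement_iSup_eigenspaces_eq_bot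
      (isCompactOperator_convolutionL2 μ _) hsymm, Submodule.mem_bot, hT, convolutionL2_apply,
      ← map_zero (ContinuousMap.toLp 2 μ ℂ)] at hTf
    have h1 := DFunLike.congr_fun (ContinuousMap.toLp_injective μ hTf) 1
    rwa [convolution_apply, map_one] at h1
  have hall : ∀ k : C(G, ℂ), inner ℂ (ContinuousMap.toLp 2 μ ℂ k) f = 0 := fun k => by
    let k' : C(G, ℂ) := ⟨fun x => star (k x⁻¹), by fun_prop⟩
    -- The Hermitian and the skew-Hermitian part of `k`.
    have h1 := hherm (k + k') fun x => by simp [k', add_comm]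
    have h2 := hherm (Complex.I • (k - k')) fun x => by simp [k']; ring
    have h3 : k = (2 : ℂ)⁻¹ • ((k + k') + (-Complex.I) • (Complex.I • (k - k'))) := by
      ext x
      simp [smul_smul]
      ring
    rw [h3, map_smul, map_add, map_smul, inner_smul_left, inner_add_left, inner_smul_left, h1, h2]
    simp
  have hdense : DenseRange (ContinuousMap.toLp 2 μ ℂ : C(G, ℂ) →L[ℂ] Lp ℂ 2 μ) :=
    ContinuousMap.toLp_denseRange ℂ μ ℂ (by norm_num)
  have h0 : ∀ g : Lp ℂ 2 μ, inner ℂ g f = 0 := fun g =>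
    hdense.induction_on g (isClosed_eq (continuous_id.inner continuous_const) continuous_const) hall
  exact inner_self_eq_zero.1 (h0 f)

end Regular

/-! ### The Hilbert basis of matrix elements -/

section HilbertBasis

variable {G : Type*} [Group G] [TopologicalSpace G]

lemma not_equiv_of_ne {U : Irr G → UnitaryIrrep G}
    (hU : ∀ δ, Quotient.mk (UnitaryIrrep.setoid G) (U δ) = δ) {δ ε : Irr G} (h : δ ≠ ε) :
    ¬ U δ ≈ U ε :=
  fun h' => h (by rw [← hU δ, ← hU ε]; exact Quotient.sound h')

lemma UnitaryIrrep.starCoeff_mem_span_of_equiv {U V : UnitaryIrrep G} (h : U ≈ V)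
    (i j : Fin V.dim) :
    V.starCoeff i j ∈
      Submodule.span ℂ (Set.range fun q : Fin U.dim × Fin U.dim => U.starCoeff q.1 q.2) := by
  obtain ⟨A, B, hAB⟩ := UnitaryIrrep.exists_conj_of_equiv h
  have h1 : V.starCoeff i j = ∑ l, ∑ k, (star (A i k) * star (B l j)) • U.starCoeff k l := by
    ext g
    simp only [UnitaryIrrep.starCoeff_apply, hAB, Matrix.mul_apply, star_sum, star_mul',
      Finset.sum_mul, ContinuousMap.coe_sum, ContinuousMap.coe_smul, Finset.sum_apply,
      Pi.smul_apply, smul_eq_mul]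
    exact Finset.sum_congr rfl fun l _ => Finset.sum_congr rfl fun k _ => by ring
  rw [h1]
  exact Submodule.sum_mem _ fun l _ => Submodule.sum_mem _ fun k _ =>
    Submodule.smul_mem _ _ (Submodule.subset_span ⟨(k, l), rfl⟩)

variable [IsTopologicalGroup G] [CompactSpace G] [MeasurableSpace G] [BorelSpace G]
  (μ : Measure G) [μ.IsHaarMeasure]

/-- The index set of the matrix elements of the chosen representatives. -/
abbrev CoeffIndex (U : Irr G → UnitaryIrrep G) : Type _ :=
  Σ δ : Irr G, Fin (U δ).dim × Fin (U δ).dim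

/-- The normalized matrix elements `√d_δ (U^δ_ij)⁻`, elements of `L²`. -/
noncomputable def coeffVector (U : Irr G → UnitaryIrrep G) (q : CoeffIndex U) : Lp ℂ 2 μ :=
  (Real.sqrt (U q.1).dim : ℂ) • ContinuousMap.toLp 2 μ ℂ ((U q.1).starCoeff q.2.1 q.2.2)

omit [IsTopologicalGroup G] in
lemma inner_toLp_starCoeff (U V : UnitaryIrrep G) (i j : Fin U.dim) (k l : Fin V.dim) :
    inner ℂ (ContinuousMap.toLp 2 μ ℂ (U.starCoeff i j))
        (ContinuousMap.toLp 2 μ ℂ (V.starCoeff k l)) = ∫ g, U.mat g i j * star (V.mat g k l) ∂μ := by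
  rw [ContinuousMap.inner_toLp]
  refine integral_congr_ae (.of_forall fun g => ?_)
  simp [UnitaryIrrep.starCoeff_apply, mul_comm]

lemma orthonormal_coeffVector [IsProbabilityMeasure μ] {U : Irr G → UnitaryIrrep G}
    (hU : ∀ δ, Quotient.mk (UnitaryIrrep.setoid G) (U δ) = δ) :
    Orthonormal ℂ (coeffVector μ U) := by
  classical
  rw [orthonormal_iff_ite]
  rintro ⟨δ, i, j⟩ ⟨ε, k, l⟩
  simp only [coeffVector, inner_smul_left, inner_smul_right, inner_toLp_starCoeff]
  by_cases h : δ = ε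
  · subst h
    rw [UnitaryIrrep.integral_mat_mul_star_mat_self]
    have hd : (Real.sqrt (U δ).dim : ℂ) * Real.sqrt (U δ).dim = (U δ).dim := by
      rw [← Complex.ofReal_mul, Real.mul_self_sqrt (Nat.cast_nonneg _), Complex.ofReal_natCast]
    have hd0 : ((U δ).dim : ℂ) ≠ 0 := by exact_mod_cast (U δ).dim_pos.ne'
    by_cases h1 : i = k ∧ j = l
    · obtain ⟨rfl, rfl⟩ := h1
      simp only [and_self, if_true, Complex.conj_ofReal]
      rw [← mul_assoc, hd, mul_inv_cancel₀ hd0]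
    · rw [if_neg h1, if_neg, mul_zero, mul_zero]
      simpa using h1
  · rw [UnitaryIrrep.integral_mat_mul_star_mat_of_not_equiv μ (not_equiv_of_ne hU (Ne.symm h)),
      if_neg (fun h' => h (congrArg Sigma.fst h')), mul_zero, mul_zero]

variable [SecondCountableTopology G] [T2Space G]

lemma topologicalClosure_span_coeffVector {U : Irr G → UnitaryIrrep G}
    (hU : ∀ δ, Quotient.mk (UnitaryIrrep.setoid G) (U δ) = δ) :
    ⊤ ≤ (Submodule.span ℂ (Set.range (coeffVector μ U))).topologicalClosure := by
  rw [← topologicalClosure_coeffSpan μ]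
  refine Submodule.topologicalClosure_mono (Submodule.span_le.2 ?_)
  rintro _ ⟨V, i, j, rfl⟩
  have h := Submodule.mem_map_of_mem
    (f := (ContinuousMap.toLp 2 μ ℂ : C(G, ℂ) →L[ℂ] Lp ℂ 2 μ).toLinearMap)
    (UnitaryIrrep.starCoeff_mem_span_of_equiv (Quotient.exact (hU (Quotient.mk _ V))) i j)
  rw [Submodule.map_span] at h
  refine Submodule.span_le.2 ?_ h
  rintro _ ⟨_, ⟨q, rfl⟩, rfl⟩
  have hd : (Real.sqrt (U (Quotient.mk _ V)).dim : ℂ) ≠ 0 := by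
    rw [Ne, Complex.ofReal_eq_zero, Real.sqrt_eq_zero (Nat.cast_nonneg _), Nat.cast_eq_zero]
    exact (U _).dim_pos.ne'
  have h1 : ContinuousMap.toLp 2 μ ℂ ((U (Quotient.mk _ V)).starCoeff q.1 q.2) =
      (Real.sqrt (U (Quotient.mk _ V)).dim : ℂ)⁻¹ • coeffVector μ U ⟨Quotient.mk _ V, q⟩ := by
    rw [coeffVector, smul_smul, inv_mul_cancel₀ hd, one_smul]
  exact h1 ▸ Submodule.smul_mem _ _ (Submodule.subset_span ⟨_, rfl⟩)

/-- The Peter–Weyl expansion: every `f` in `L²` is the sum of its Fourier series. -/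
theorem hasSum_coeffVector [IsProbabilityMeasure μ] {U : Irr G → UnitaryIrrep G}
    (hU : ∀ δ, Quotient.mk (UnitaryIrrep.setoid G) (U δ) = δ) (f : Lp ℂ 2 μ) :
    HasSum (fun q => (inner ℂ (coeffVector μ U q) f : ℂ) • coeffVector μ U q) f := by
  let b := HilbertBasis.mk (orthonormal_coeffVector μ hU) (topologicalClosure_span_coeffVector μ hU)
  have h := b.hasSum_repr f
  simpa only [b.repr_apply_apply, b, HilbertBasis.coe_mk] using h

end HilbertBasis

/-! ### Characteristic functions of random variables on a group -/

section CharMatrix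

variable {G : Type*} [Group G] [TopologicalSpace G] [MeasurableSpace G] [BorelSpace G]
  {Ω : Type*} [MeasurableSpace Ω] {P : Measure Ω}

omit [MeasurableSpace G] [BorelSpace G] in
lemma charMatrix_apply (X : Ω → G) (U : UnitaryIrrep G) (i j : Fin U.dim) :
    charMatrix P X U i j = ∫ w, U.mat (X w) i j ∂P := rfl

lemma UnitaryIrrep.measurable_mat_apply (U : UnitaryIrrep G) (i j : Fin U.dim) :
    Measurable fun g => U.mat g i j := (U.continuous_mat_apply i j).measurable

lemma integrable_mat_comp [IsFiniteMeasure P] {X : Ω → G} (hX : AEMeasurable X P)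
    (U : UnitaryIrrep G) (i j : Fin U.dim) : Integrable (fun w => U.mat (X w) i j) P :=
  .of_bound ((U.measurable_mat_apply i j).comp_aemeasurable hX).aestronglyMeasurable 1
    (.of_forall fun w => U.norm_mat_apply_le (X w) i j)

lemma charMatrix_eq_of_identDistrib {Ω' : Type*} [MeasurableSpace Ω'] {P' : Measure Ω'}
    {X : Ω → G} {Y : Ω' → G} (h : IdentDistrib X Y P P') (U : UnitaryIrrep G) :
    charMatrix P X U = charMatrix P' Y U := by
  ext i j
  exact (h.comp (U.measurable_mat_apply i j)).integral_eq

/-- The characteristic function of a product of independent variables is the product. -/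
lemma charMatrix_mul [IsFiniteMeasure P] {X Y : Ω → G} (hXY : IndepFun X Y P)
    (hX : AEMeasurable X P) (hY : AEMeasurable Y P) (U : UnitaryIrrep G) :
    charMatrix P (fun w => X w * Y w) U = charMatrix P X U * charMatrix P Y U := by
  ext i j
  simp only [charMatrix_apply, Matrix.mul_apply, U.mat_mul]
  rw [integral_finsetSum]
  · refine Finset.sum_congr rfl fun k _ => ?_
    exact hXY.integral_fun_comp_mul_comp hX hY (U.measurable_mat_apply i k).aestronglyMeasurable
      (U.measurable_mat_apply k j).aestronglyMeasurable
  · intro k _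
    refine Integrable.bdd_mul (c := 1) (integrable_mat_comp hY U k j) ?_
      (.of_forall fun w => U.norm_mat_apply_le (X w) i k)
    exact (integrable_mat_comp hX U i k).aestronglyMeasurable

/-- The characteristic function of a variable with the law of its inverse is Hermitian. -/
lemma isHermitian_charMatrix {X : Ω → G} (h : IdentDistrib X (fun w => (X w)⁻¹) P P)
    (U : UnitaryIrrep G) : (charMatrix P X U).IsHermitian := by
  ext i j
  rw [Matrix.conjTranspose_apply]
  conv_rhs => rw [charMatrix_eq_of_identDistrib h U]
  simp only [charMatrix_apply, U.mat_inv_apply]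
  exact integral_conj.symm

/-! ### The compounding transformation -/

/-- The product `x₀ x₁ ⋯ x_{k-1}` of the first `k` terms of a sequence. -/
def initialProd (k : ℕ) (x : ℕ → G) : G := (List.ofFn fun i : Fin k => x i).prod

omit [TopologicalSpace G] [MeasurableSpace G] [BorelSpace G] in
lemma initialProd_succ (k : ℕ) (x : ℕ → G) : initialProd (k + 1) x = initialProd k x * x k := by
  rw [initialProd, List.ofFn_succ_last]
  simp [initialProd]

variable [MeasurableMul₂ G]

omit [TopologicalSpace G] [BorelSpace G] in
lemma measurable_prod_ofFn {α : Type*} [MeasurableSpace α] {k : ℕ} {f : Fin k → α → G}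
    (hf : ∀ i, Measurable (f i)) : Measurable fun a => (List.ofFn fun i => f i a).prod := by
  have h := List.measurable_fun_prod (List.ofFn f) (by
    intro g hg
    obtain ⟨i, rfl⟩ := List.mem_ofFn.1 hg
    exact hf i)
  simpa [List.map_ofFn, Function.comp_def] using h

omit [TopologicalSpace G] [BorelSpace G] in
lemma measurable_initialProd (k : ℕ) : Measurable (initialProd k : (ℕ → G) → G) :=
  measurable_prod_ofFn fun _ => measurable_pi_apply _

lemma charMatrix_initialProd [IsProbabilityMeasure P] {X : ℕ → Ω → G} (hX : ∀ n, Measurable (X n))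
    (hind : iIndepFun X P) (U : UnitaryIrrep G) {A : Matrix (Fin U.dim) (Fin U.dim) ℂ}
    (hA : ∀ n, charMatrix P (X n) U = A) (k : ℕ) :
    charMatrix P (fun w => initialProd k fun n => X n w) U = A ^ k := by
  induction k with
  | zero => ext i j; simp [charMatrix_apply, initialProd, U.mat_one]
  | succ k ih =>
    simp only [initialProd_succ]
    have hprod : Measurable fun w => initialProd k fun n => X n w :=
      (measurable_initialProd k).comp (measurable_pi_iff.2 hX)
    have hi : IndepFun (fun w => initialProd k fun n => X n w) (X k) P := by
      have h1 := hind.indepFun_finset (Finset.range k) {k} (by simp) hX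
      have h2 : Measurable fun x : (Finset.range k → G) =>
          (List.ofFn fun i : Fin k => x ⟨i, Finset.mem_range.2 i.2⟩).prod :=
        measurable_prod_ofFn fun _ => measurable_pi_apply _
      have h3 : Measurable fun x : (({k} : Finset ℕ) → G) => x ⟨k, Finset.mem_singleton_self k⟩ :=
        measurable_pi_apply _
      exact h1.comp h2 h3
    rw [charMatrix_mul hi hprod.aemeasurable (hX k).aemeasurable, ih, hA, pow_succ]

omit [TopologicalSpace G] [BorelSpace G] in
lemma measurable_compoundPoisson {N : ℝ≥0 → Ω → ℕ} {X : ℕ → Ω → G} (hX : ∀ n, Measurable (X n))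
    {t : ℝ≥0} (hN : Measurable (N t)) : Measurable (compoundPoisson N X t) := by
  have h : Measurable fun q : ℕ × (ℕ → G) => initialProd q.1 q.2 :=
    measurable_from_prod_countable_right measurable_initialProd
  exact h.comp (hN.prodMk (measurable_pi_iff.2 hX))

lemma map_poissonProcess {lam : ℝ≥0} {N : ℝ≥0 → Ω → ℕ} (hN : IsPoissonProcess P lam N) (t : ℝ≥0) :
    P.map (N t) = poissonMeasure (lam * t) := by
  have h := hN.law_increments 0 t zero_le
  rw [tsub_zero] at h
  rw [← h]
  refine Measure.map_congr ?_
  filter_upwards [hN.zero] with w hw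
  rw [hw, Nat.sub_zero]

open scoped Matrix.Norms.L2Operator

lemma exp_neg_smul_one {n : Type*} [Fintype n] [DecidableEq n] (s : ℝ) :
    NormedSpace.exp (-((s : ℂ) • (1 : Matrix n n ℂ))) = (Real.exp (-s) : ℂ) • 1 := by
  rw [← neg_smul, ← Algebra.algebraMap_eq_smul_one, ← NormedSpace.algebraMap_exp_comm,
    Algebra.algebraMap_eq_smul_one, ← Complex.exp_eq_exp_ℂ, Complex.ofReal_exp]
  simp

/-- Conditioning on the number of jumps: the characteristic function of a compound Poisson variable
is the exponential of that of the jumps. -/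
lemma charMatrix_compoundPoisson [IsProbabilityMeasure P] {lam : ℝ≥0} {N : ℝ≥0 → Ω → ℕ}
    (hN : IsPoissonProcess P lam N) {X : ℕ → Ω → G} (hX : ∀ n, Measurable (X n))
    (hind : iIndepFun X P)
    (hXN : IndepFun (fun w (n : ℕ) => X n w) (fun w (t : ℝ≥0) => N t w) P) (t : ℝ≥0)
    (U : UnitaryIrrep G) {A : Matrix (Fin U.dim) (Fin U.dim) ℂ}
    (hA : ∀ n, charMatrix P (X n) U = A) :
    charMatrix P (compoundPoisson N X t) U =
      NormedSpace.exp (((lam * t : ℝ≥0) : ℂ) • A - ((lam * t : ℝ≥0) : ℂ) • 1) := by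
  set r : ℝ≥0 := lam * t with hr
  have hNt : Measurable (N t) := hN.measurable t
  have hsum : ∀ i j, HasSum (fun k : ℕ => (Real.exp (-r) * r ^ k / (k.factorial : ℝ) : ℂ) *
      (A ^ k) i j) (charMatrix P (compoundPoisson N X t) U i j) := fun i j => by
    have hU : ⋃ k, N t ⁻¹' {k} = Set.univ := by ext w; simp
    have h1 := hasSum_integral_iUnion (μ := P) (s := fun k => N t ⁻¹' {k})
      (f := fun w => U.mat (compoundPoisson N X t w) i j)
      (fun k => hNt (measurableSet_singleton k))
      (fun k l hkl => Set.disjoint_left.2 fun w hk hl => hkl (hk.symm.trans hl))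
      (integrable_mat_comp (measurable_compoundPoisson hX hNt).aemeasurable U i j).integrableOn
    rw [hU, Measure.restrict_univ] at h1
    refine h1.congr_fun fun k => ?_
    have h2 : Measurable fun w => initialProd k fun n => X n w :=
      (measurable_initialProd k).comp (measurable_pi_iff.2 hX)
    have h3 : IndepFun (N t) (fun w => initialProd k fun n => X n w) P :=
      (hXN.comp (measurable_initialProd k) (measurable_pi_apply t)).symm
    have h4 := h3.integral_fun_comp_mul_comp (𝕜 := ℂ) (f := Set.indicator {k} 1)
      (g := fun g => U.mat g i j) hNt.aemeasurable h2.aemeasurable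
      (Measurable.of_discrete).aestronglyMeasurable
      (U.measurable_mat_apply i j).aestronglyMeasurable
    have h5 : ∫ w, Set.indicator {k} 1 (N t w) ∂P = (Real.exp (-r) * r ^ k / (k.factorial : ℝ) : ℂ)
        := by
      rw [← integral_map (f := Set.indicator {k} (1 : ℕ → ℂ)) hNt.aemeasurable
        (Measurable.of_discrete).aestronglyMeasurable, map_poissonProcess hN,
        integral_indicator (measurableSet_singleton k)]
      simp only [Pi.one_apply, setIntegral_const, poissonMeasure_real_singleton, ← hr]
      simp
    rw [h5] at h4
    rw [← charMatrix_initialProd hX hind U hA k, charMatrix_apply]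
    refine h4.symm.trans ?_
    rw [← integral_indicator (hNt (measurableSet_singleton k))]
    refine integral_congr_ae (.of_forall fun w => ?_)
    by_cases hw : N t w = k
    · simp [hw, compoundPoisson, initialProd]
    · simp [hw]
  have hexp : NormedSpace.exp ((r : ℂ) • A - (r : ℂ) • 1) =
      (Real.exp (-r) : ℂ) • NormedSpace.exp ((r : ℂ) • A) := by
    rw [sub_eq_add_neg, Matrix.exp_add_of_commute, exp_neg_smul_one, mul_smul_comm, mul_one]
    exact ((Commute.one_right _).smul_right _).neg_right
  ext i j
  refine (hsum i j).unique ?_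
  have h2 := (NormedSpace.exp_series_hasSum_exp' (𝕂 := ℂ) ((r : ℂ) • A)).const_smul
    (Real.exp (-r) : ℂ)
  rw [← hexp] at h2
  refine (Pi.hasSum.1 (Pi.hasSum.1 h2 i) j).congr_fun fun k => ?_
  simp only [smul_pow, Matrix.smul_apply, smul_eq_mul]
  push_cast
  ring

end CharMatrix

/-! ### The logarithm of positive definite matrices -/

section Log

variable {n : Type*} [Fintype n] [DecidableEq n]

open Classical in
/-- The function of a matrix that produces the parametric estimate from the empirical
characteristic function: an affine function of the logarithm if the spectrum is positive, and zero
otherwise. -/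
noncomputable def logEstimate (c b : ℂ) (S : Matrix n n ℂ) : Matrix n n ℂ :=
  if spectrum ℂ S ⊆ (fun x : ℝ => (x : ℂ)) '' Set.Ioi 0 then c • cfc Real.log S + b • 1 else 0

/-- The Hermitian part of a matrix. -/
noncomputable def hermitianPart (S : Matrix n n ℂ) : Matrix n n ℂ := (1 / 2 : ℂ) • (S + Sᴴ)

omit [Fintype n] [DecidableEq n] in
lemma isHermitian_hermitianPart (S : Matrix n n ℂ) : (hermitianPart S).IsHermitian := by
  rw [hermitianPart, Matrix.IsHermitian, Matrix.conjTranspose_smul, Matrix.conjTranspose_add,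
    Matrix.conjTranspose_conjTranspose, add_comm]
  simp

omit [Fintype n] [DecidableEq n] in
lemma hermitianPart_of_isHermitian {S : Matrix n n ℂ} (h : S.IsHermitian) :
    hermitianPart S = S := by
  rw [hermitianPart, h.eq, ← two_smul ℂ S, smul_smul]
  norm_num

omit [Fintype n] [DecidableEq n] in
lemma continuous_hermitianPart : Continuous (hermitianPart : Matrix n n ℂ → Matrix n n ℂ) := by
  unfold hermitianPart
  fun_prop

open scoped Matrix.Norms.L2Operator

lemma spectrum_exp_subset {B : Matrix n n ℂ} (hB : B.IsHermitian) :
    spectrum ℝ (NormedSpace.exp B) ⊆ Set.Ioi 0 := by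
  have hB' : IsSelfAdjoint B := hB
  rw [← CFC.real_exp_eq_normedSpace_exp hB', cfc_map_spectrum Real.exp B]
  rintro _ ⟨x, -, rfl⟩
  exact Real.exp_pos x

lemma spectrum_complex_subset {S : Matrix n n ℂ} (hS : S.IsHermitian)
    (h : spectrum ℝ S ⊆ Set.Ioi 0) :
    spectrum ℂ S ⊆ (fun x : ℝ => (x : ℂ)) '' Set.Ioi 0 := by
  have hS' : IsSelfAdjoint S := hS
  rw [← hS'.spectrumRestricts.algebraMap_image]
  exact Set.image_mono h

lemma logEstimate_exp (c b : ℂ) {B : Matrix n n ℂ} (hB : B.IsHermitian) :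
    logEstimate c b (NormedSpace.exp B) = c • B + b • 1 := by
  rw [logEstimate, if_pos (spectrum_complex_subset hB.exp (spectrum_exp_subset hB))]
  congr 2
  exact CFC.log_exp B hB

/-- Near a positive definite matrix, Hermitian matrices are positive definite, and the logarithm is
continuous. -/
lemma continuousWithinAt_logEstimate (c b : ℂ) {B : Matrix n n ℂ} (hB : B.IsHermitian) :
    ContinuousWithinAt (logEstimate c b) {S : Matrix n n ℂ | S.IsHermitian}
      (NormedSpace.exp B) := by
  have hpos : ∀ᶠ S in 𝓝 (NormedSpace.exp B), spectrum ℝ S ⊆ Set.Ioi 0 :=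
    ((upperHemicontinuous_spectrum ℝ (Matrix n n ℂ)).upperHemicontinuousAt (NormedSpace.exp B)
      (Set.Ioi 0) (isOpen_Ioi.mem_nhdsSet.2 (spectrum_exp_subset hB))).mono
      fun _ => subset_of_mem_nhdsSet
  have hlog : ContinuousWithinAt CFC.log {S : Matrix n n ℂ | S.IsHermitian}
      (NormedSpace.exp B) := by
    have h1 := CFC.continuousOn_log (A := Matrix n n ℂ) (NormedSpace.exp B)
      ⟨hB.exp, Matrix.isUnit_exp B⟩
    refine h1.mono_of_mem_nhdsWithin ?_
    filter_upwards [self_mem_nhdsWithin, mem_nhdsWithin_of_mem_nhds hpos] with S hS hS'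
    exact ⟨hS, spectrum.isUnit_of_zero_notMem ℝ fun h0 => lt_irrefl (0 : ℝ) (hS' h0)⟩
  have h2 : ContinuousWithinAt (fun S => c • CFC.log S + b • (1 : Matrix n n ℂ))
      {S : Matrix n n ℂ | S.IsHermitian} (NormedSpace.exp B) :=
    (hlog.const_smul c).add continuousWithinAt_const
  refine h2.congr_of_eventuallyEq ?_ ?_
  · filter_upwards [self_mem_nhdsWithin, mem_nhdsWithin_of_mem_nhds hpos] with S hS hS'
    rw [logEstimate, if_pos (spectrum_complex_subset hS hS')]
    rfl
  · rw [logEstimate, if_pos (spectrum_complex_subset hB.exp (spectrum_exp_subset hB))]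
    rfl

/-- The estimate, as a function of a matrix that need not be Hermitian, is continuous at `exp B`. -/
lemma continuousAt_logEstimate_hermitianPart (c b : ℂ) {B : Matrix n n ℂ} (hB : B.IsHermitian) :
    ContinuousAt (fun S => logEstimate c b (hermitianPart S)) (NormedSpace.exp B) := by
  have h := continuousWithinAt_logEstimate c b hB
  rw [← hermitianPart_of_isHermitian hB.exp] at h
  exact ContinuousWithinAt.tendsto h |>.comp
    (tendsto_nhdsWithin_of_tendsto_nhds_of_eventually_within _
      continuous_hermitianPart.continuousAt (.of_forall isHermitian_hermitianPart))

/-- The scalar factor of the noise shifts the exponent by a multiple of the identity. -/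
lemma exp_smul_exp_sub (s r : ℝ) (A : Matrix n n ℂ) :
    (Real.exp (-s) : ℂ) • NormedSpace.exp ((r : ℂ) • A - (r : ℂ) • 1) =
      NormedSpace.exp ((r : ℂ) • A - ((r + s : ℝ) : ℂ) • 1) := by
  have h2 : (r : ℂ) • A - ((r + s : ℝ) : ℂ) • 1 = ((r : ℂ) • A - (r : ℂ) • 1) + -((s : ℂ) • 1) := by
    push_cast
    rw [add_smul]
    abel
  rw [h2, Matrix.exp_add_of_commute, exp_neg_smul_one, mul_smul_comm, mul_one]
  exact ((Commute.one_right _).smul_right _).neg_right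

end Log

/-! ### Convergence in measure -/

section InMeasure

variable {Ω : Type*} [MeasurableSpace Ω] {P : Measure Ω}

/-- The continuous mapping theorem for a constant limit, without measurability of the function. -/
lemma tendstoInMeasure_comp_of_continuousAt {β γ : Type*} [PseudoEMetricSpace β]
    [PseudoEMetricSpace γ] {f : ℕ → Ω → β} {a : β} (hf : TendstoInMeasure P f atTop fun _ => a)
    {Ψ : β → γ} (hΨ : ContinuousAt Ψ a) :
    TendstoInMeasure P (fun n w => Ψ (f n w)) atTop fun _ => Ψ a := by
  intro ε hε
  obtain ⟨η, hη, h⟩ := Metric.nhds_basis_eball.tendsto_iff Metric.nhds_basis_eball |>.1 hΨ ε hε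
  refine tendsto_of_tendsto_of_tendsto_of_le_of_le tendsto_const_nhds (hf η hη) (fun _ => zero_le)
    fun n => measure_mono fun w hw => ?_
  by_contra hlt
  have h1 : edist (f n w) a < η := not_le.1 hlt
  have h2 : edist (Ψ (f n w)) (Ψ a) < ε := h _ h1
  exact absurd hw (not_le.2 h2)

end InMeasure

/-! ### Fourier sums and the Fourier expansion of a density -/

section FourierSum

variable {G : Type*} [Group G] [TopologicalSpace G]

/-- The function `g ↦ d tr(A U(g)†)`. -/
noncomputable def fourierTerm (U : UnitaryIrrep G) (A : Matrix (Fin U.dim) (Fin U.dim) ℂ) :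
    C(G, ℂ) :=
  (U.dim : ℂ) • ∑ i, ∑ j, A i j • U.starCoeff i j

lemma fourierTerm_apply (U : UnitaryIrrep G) (A : Matrix (Fin U.dim) (Fin U.dim) ℂ) (g : G) :
    fourierTerm U A g = U.dim * (A * (U.mat g)ᴴ).trace := by
  simp [fourierTerm, Matrix.trace, Matrix.mul_apply, UnitaryIrrep.starCoeff_apply,
    ContinuousMap.coe_sum]

lemma continuous_fourierTerm (U : UnitaryIrrep G) :
    Continuous fun A => fourierTerm U A := by
  unfold fourierTerm
  fun_prop

lemma fourierTerm_one_of_equiv_unit {U : UnitaryIrrep G} (h : UnitaryIrrep.unit G ≈ U) :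
    fourierTerm U 1 = 1 := by
  ext g
  rw [fourierTerm_apply, UnitaryIrrep.mat_eq_one_of_equiv_unit h]
  simp [UnitaryIrrep.dim_eq_one_of_equiv_unit h]

variable [IsTopologicalGroup G] [CompactSpace G] [MeasurableSpace G] [BorelSpace G]
  (μ : Measure G) [μ.IsHaarMeasure] [IsProbabilityMeasure μ]

omit [IsTopologicalGroup G] in
lemma sum_inner_coeffVector (U : Irr G → UnitaryIrrep G) (δ : Irr G) (f : Lp ℂ 2 μ)
    {A : Matrix (Fin (U δ).dim) (Fin (U δ).dim) ℂ}
    (hA : ∀ i j, A i j = inner ℂ (ContinuousMap.toLp 2 μ ℂ ((U δ).starCoeff i j)) f) :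
    ∑ q : Fin (U δ).dim × Fin (U δ).dim,
      (inner ℂ (coeffVector μ U ⟨δ, q⟩) f : ℂ) • coeffVector μ U ⟨δ, q⟩ =
      ContinuousMap.toLp 2 μ ℂ (fourierTerm (U δ) A) := by
  have hd : (Real.sqrt (U δ).dim : ℂ) * Real.sqrt (U δ).dim = (U δ).dim := by
    rw [← Complex.ofReal_mul, Real.mul_self_sqrt (Nat.cast_nonneg _), Complex.ofReal_natCast]
  simp only [fourierTerm, map_smul, map_sum, Finset.smul_sum, Fintype.sum_prod_type, hA]
  refine Finset.sum_congr rfl fun i _ => Finset.sum_congr rfl fun j _ => ?_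
  rw [coeffVector, inner_smul_left, smul_smul, smul_smul, Complex.conj_ofReal, ← hd]
  congr 1
  ring

variable [SecondCountableTopology G] [T2Space G]

/-- The partial sums of the Fourier expansion along an exhausting sequence of finite sets of
nontrivial representations, with the term of the unit representation added. -/
lemma tendsto_fourierSum {U : Irr G → UnitaryIrrep G}
    (hU : ∀ δ, Quotient.mk (UnitaryIrrep.setoid G) (U δ) = δ)
    {Γ : ℕ → Finset (Irr G)} (hΓ : Monotone Γ) (hΓ' : ∀ δ, (∃ l, δ ∈ Γ l) ↔ δ ≠ Irr.unit G)
    (f : Lp ℂ 2 μ) (A : ∀ δ, Matrix (Fin (U δ).dim) (Fin (U δ).dim) ℂ)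
    (hA : ∀ δ i j, A δ i j = inner ℂ (ContinuousMap.toLp 2 μ ℂ ((U δ).starCoeff i j)) f) :
    Tendsto (fun l => ContinuousMap.toLp 2 μ ℂ
      (fourierTerm (U (Irr.unit G)) (A (Irr.unit G)) + ∑ δ ∈ Γ l, fourierTerm (U δ) (A δ)))
      atTop (𝓝 f) := by
  classical
  let S : ℕ → Finset (CoeffIndex U) := fun l =>
    (insert (Irr.unit G) (Γ l)).sigma fun _ => Finset.univ
  have hS : Tendsto S atTop atTop := by
    refine tendsto_atTop_finset_of_monotone (fun k l hkl => ?_) fun q => ?_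
    · exact Finset.sigma_mono (Finset.insert_subset_insert _ (hΓ hkl)) fun _ => le_rfl
    · by_cases hq : q.1 = Irr.unit G
      · exact ⟨0, by simp [S, hq]⟩
      · obtain ⟨l, hl⟩ := (hΓ' q.1).2 hq
        exact ⟨l, by simp [S, hl]⟩
  refine ((hasSum_coeffVector μ hU f).comp hS).congr fun l => ?_
  have hnot : Irr.unit G ∉ Γ l := fun h => (hΓ' _).1 ⟨l, h⟩ rfl
  simp only [Function.comp_apply, S, Finset.sum_sigma]
  rw [Finset.sum_insert hnot, sum_inner_coeffVector μ U _ f (hA _), map_add, map_sum]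
  congr 1
  exact Finset.sum_congr rfl fun δ _ => sum_inner_coeffVector μ U _ f (hA _)

omit [IsTopologicalGroup G] [SecondCountableTopology G] [T2Space G] [μ.IsHaarMeasure] in
/-- The characteristic function of a variable with density `p` in `L²` consists of the Fourier
coefficients of `p`. -/
lemma charMatrix_eq_inner {Ω : Type*} [MeasurableSpace Ω] {P : Measure Ω} {X : Ω → G}
    (hX : AEMeasurable X P) {p : G → ℝ} (hp : MemLp (fun g => (p g : ℂ)) 2 μ)
    (hpm : AEMeasurable p μ) (hp0 : ∀ᵐ g ∂μ, 0 ≤ p g)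
    (hXp : P.map X = μ.withDensity fun g => ENNReal.ofReal (p g))
    (U : UnitaryIrrep G) (i j : Fin U.dim) :
    charMatrix P X U i j = inner ℂ (ContinuousMap.toLp 2 μ ℂ (U.starCoeff i j)) (hp.toLp _) := by
  rw [charMatrix_apply, ← integral_map (f := fun g => U.mat g i j) hX
    (U.measurable_mat_apply i j).aestronglyMeasurable, hXp,
    integral_withDensity_eq_integral_toReal_smul₀ hpm.ennreal_ofReal
      (.of_forall fun _ => ENNReal.ofReal_lt_top), L2.inner_def]
  refine integral_congr_ae ?_
  filter_upwards [hp0, hp.coeFn_toLp,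
    ContinuousMap.coeFn_toLp (p := 2) (𝕜 := ℂ) μ (U.starCoeff i j)] with g h0 h1 h2
  rw [h1, h2, RCLike.inner_apply', ENNReal.toReal_ofReal h0, UnitaryIrrep.starCoeff_apply]
  simp [mul_comm]

end FourierSum

/-! ### The law of large numbers for the empirical characteristic function -/

section Empirical

variable {G : Type*} [Group G] [TopologicalSpace G] [MeasurableSpace G] [BorelSpace G]
  {Ω : Type*} [MeasurableSpace Ω] {P : Measure Ω} [IsProbabilityMeasure P]

/-- The matrix elements of the averages `(1 / n) ∑_{k < n} U(Z_k)`, for finitely many `U`. -/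
noncomputable def empiricalMean (Z : ℕ → Ω → G) {ι : Type*} (U : ι → UnitaryIrrep G) (n : ℕ)
    (w : Ω) : ∀ δ : ι, Fin (U δ).dim → Fin (U δ).dim → ℂ :=
  fun δ i j => (n : ℝ)⁻¹ • ∑ k ∈ Finset.range n, (U δ).mat (Z k w) i j

lemma tendstoInMeasure_empiricalMean {Z : ℕ → Ω → G} (hZ : iIndepFun Z P)
    (hident : ∀ n, IdentDistrib (Z n) (Z 0) P P) {ι : Type*} [Fintype ι]
    (U : ι → UnitaryIrrep G) :
    TendstoInMeasure P (empiricalMean Z U) atTop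
      fun _ => fun δ i j => charMatrix P (Z 0) (U δ) i j := by
  have hm : ∀ n, AEMeasurable (Z n) P := fun n => (hident n).aemeasurable_fst
  refine tendstoInMeasure_of_tendsto_ae (fun n => ?_) ?_
  · refine AEMeasurable.aestronglyMeasurable ?_
    refine aemeasurable_pi_iff.2 fun δ => aemeasurable_pi_iff.2 fun i =>
      aemeasurable_pi_iff.2 fun j => ?_
    have h : AEMeasurable (fun w => ∑ k ∈ Finset.range n, (U δ).mat (Z k w) i j) P :=
      Finset.aemeasurable_fun_sum _ fun k _ =>
        ((U δ).measurable_mat_apply i j).comp_aemeasurable (hm k)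
    exact h.const_smul (n : ℝ)⁻¹
  · have h : ∀ᵐ w ∂P, ∀ δ i j, Tendsto (fun n => empiricalMean Z U n w δ i j) atTop
        (𝓝 (charMatrix P (Z 0) (U δ) i j)) := by
      simp only [ae_all_iff]
      intro δ i j
      have hmeas := (U δ).measurable_mat_apply i j
      exact strong_law_ae (fun n w => (U δ).mat (Z n w) i j) (integrable_mat_comp (hm 0) (U δ) i j)
        (fun k l hkl => (hZ.indepFun hkl).comp hmeas hmeas) fun n => (hident n).comp hmeas
    filter_upwards [h] with w hw
    simp only [tendsto_pi_nhds]
    exact hw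

end Empirical

/-! ### Convergence of the estimates -/

section Estimates

variable {G : Type*} [Group G] [TopologicalSpace G] [CompactSpace G] [MeasurableSpace G]
  [BorelSpace G] (μ : Measure G) [IsFiniteMeasure μ]

omit [Group G] in
lemma toReal_eLpNorm_sub_eq_norm (φ : C(G, ℂ)) {p : G → ℂ} (hp : MemLp p 2 μ) :
    (eLpNorm (fun g => φ g - p g) 2 μ).toReal = ‖ContinuousMap.toLp 2 μ ℂ φ - hp.toLp p‖ := by
  have h1 : ContinuousMap.toLp 2 μ ℂ φ = (φ.memLp (p := 2) (μ := μ) ℂ).toLp φ := rfl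
  rw [h1, ← MemLp.toLp_sub, Lp.norm_toLp]
  rfl

/-- The `L²` distance to `f` of the Fourier sum whose coefficients are the estimates computed from
the matrices `S δ` is a continuous function of `S` at exponentials of Hermitian matrices. -/
lemma continuousAt_norm_fourierSum {ι : Type*} [Fintype ι] (U : ι → UnitaryIrrep G)
    (f : Lp ℂ 2 μ) (c : ℂ) (b : ι → ℂ) {B : ∀ δ, Matrix (Fin (U δ).dim) (Fin (U δ).dim) ℂ}
    (hB : ∀ δ, (B δ).IsHermitian) :
    ContinuousAt (fun S : ∀ δ, Fin (U δ).dim → Fin (U δ).dim → ℂ =>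
      ‖ContinuousMap.toLp 2 μ ℂ (1 + ∑ δ, fourierTerm (U δ)
        (logEstimate c (b δ) (hermitianPart (Matrix.of (S δ))))) - f‖)
      (fun δ i j => NormedSpace.exp (B δ) i j) := by
  have h : ∀ δ, ContinuousAt (fun S : ∀ δ, Fin (U δ).dim → Fin (U δ).dim → ℂ =>
      fourierTerm (U δ) (logEstimate c (b δ) (hermitianPart (Matrix.of (S δ)))))
      (fun δ i j => NormedSpace.exp (B δ) i j) := fun δ => by
    have h1 := (continuous_fourierTerm (U δ)).continuousAt.comp
      (continuousAt_logEstimate_hermitianPart c (b δ) (hB δ))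
    have h2 : Tendsto (fun S : ∀ δ, Fin (U δ).dim → Fin (U δ).dim → ℂ => Matrix.of (S δ))
        (𝓝 fun δ i j => NormedSpace.exp (B δ) i j) (𝓝 (NormedSpace.exp (B δ))) :=
      Continuous.tendsto (continuous_apply δ) _
    exact h1.tendsto.comp h2
  refine ContinuousAt.norm (ContinuousAt.sub ?_ continuousAt_const)
  refine (ContinuousMap.toLp 2 μ ℂ).continuous.continuousAt.comp ?_
  exact continuousAt_const.add (tendsto_finsetSum _ fun δ _ => h δ)

variable {E : Type*} [NormedAddCommGroup E] [NormedSpace ℝ E] [FiniteDimensional ℝ E]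
  [ChartedSpace E G] [LieGroup 𝓘(ℝ, E) ∞ G] {Ω : Type*}

omit [CompactSpace G] [MeasurableSpace G] [BorelSpace G] in
lemma paramEstimate_eq_logEstimate (m : Metric E G) (T lam : ℝ≥0) (σ : ℝ) (Z : ℕ → Ω → G)
    (U : UnitaryIrrep G) (n : ℕ) (w : Ω) :
    paramEstimate m T lam σ Z U n w =
      logEstimate (1 / (T * lam)) ((lambdaBar m T lam σ U / lam : ℝ) : ℂ) (empiricalChar Z U n w) :=
  rfl

omit [CompactSpace G] [MeasurableSpace G] [BorelSpace G] in
lemma empiricalChar_eq_hermitianPart (Z : ℕ → Ω → G) {ι : Type*} (U : ι → UnitaryIrrep G) (n : ℕ)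
    (w : Ω) (δ : ι) :
    empiricalChar Z (U δ) n w = hermitianPart (Matrix.of (empiricalMean Z U n w δ)) := by
  ext i j
  simp only [empiricalChar, hermitianPart, empiricalMean, Matrix.smul_apply, Matrix.add_apply,
    Matrix.of_apply, Matrix.conjTranspose_apply, Matrix.sum_apply, Finset.sum_add_distrib,
    smul_eq_mul, Complex.real_smul]
  simp
  ring

omit [CompactSpace G] [MeasurableSpace G] [BorelSpace G] in
lemma nonparamEstimate_eq_fourierSum (m : Metric E G) (T lam : ℝ≥0) (σ : ℝ)
    (U : Irr G → UnitaryIrrep G) (Γ : Finset (Irr G)) (Z : ℕ → Ω → G) (n : ℕ) (w : Ω) :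
    nonparamEstimate m T lam σ 0 U Γ Z n w =
      ⇑(1 + ∑ δ ∈ Γ, fourierTerm (U δ) (paramEstimate m T lam σ Z (U δ) n w)) := by
  ext g
  simp [nonparamEstimate, fourierTerm_apply, ContinuousMap.coe_sum]

lemma toReal_eLpNorm_nonparamEstimate_sub (m : Metric E G) (T lam : ℝ≥0) (σ : ℝ)
    (U : Irr G → UnitaryIrrep G) (Γ : Finset (Irr G)) (Z : ℕ → Ω → G) (n : ℕ) (w : Ω) {p : G → ℂ}
    (hp : MemLp p 2 μ) :
    (eLpNorm (fun g => nonparamEstimate m T lam σ 0 U Γ Z n w g - p g) 2 μ).toReal =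
      ‖ContinuousMap.toLp 2 μ ℂ (1 + ∑ δ : Γ, fourierTerm (U δ)
        (logEstimate (1 / (T * lam)) ((lambdaBar m T lam σ (U δ) / lam : ℝ) : ℂ)
          (hermitianPart (Matrix.of (empiricalMean Z (fun δ : Γ => U δ) n w δ))))) -
        hp.toLp p‖ := by
  rw [nonparamEstimate_eq_fourierSum, toReal_eLpNorm_sub_eq_norm μ _ hp, ← Finset.sum_coe_sort Γ]
  simp only [paramEstimate_eq_logEstimate,
    ← empiricalChar_eq_hermitianPart Z (fun δ : Γ => U δ)]

omit [CompactSpace G] in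
/-- The compounding transformation: the characteristic function of the noisy observations is the
exponential of an affine function of that of the jumps. -/
lemma charMatrix_noise_mul_compoundPoisson [MeasurableMul₂ G] {m : Metric E G} [MeasurableSpace Ω]
    {P : Measure Ω} [IsProbabilityMeasure P] {T lam : ℝ≥0} (hT : 0 < T) {σ : ℝ}
    {N : ℝ≥0 → Ω → ℕ} (hN : IsPoissonProcess P lam N) {X : ℕ → Ω → G} (hX : ∀ n, Measurable (X n))
    (hind : iIndepFun X P)
    (hXN : IndepFun (fun w (n : ℕ) => X n w) (fun w (t : ℝ≥0) => N t w) P)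
    {M : Ω → G} (hM : Measurable M) (hMlaw : IsBrownianNoise m σ P M)
    (hMY : IndepFun M (fun w (t : ℝ≥0) => compoundPoisson N X t w) P)
    (U : UnitaryIrrep G) {A : Matrix (Fin U.dim) (Fin U.dim) ℂ}
    (hA : ∀ n, charMatrix P (X n) U = A) :
    charMatrix P (fun w => M w * compoundPoisson N X T w) U =
      NormedSpace.exp (((T * lam : ℝ) : ℂ) • A - ((T * lambdaBar m T lam σ U : ℝ) : ℂ) • 1) := by
  have hY : Measurable (compoundPoisson N X T) := measurable_compoundPoisson hX (hN.measurable T)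
  have hi : IndepFun M (compoundPoisson N X T) P := hMY.comp measurable_id (measurable_pi_apply T)
  have hT' : (T : ℝ) ≠ 0 := by exact_mod_cast hT.ne'
  have hbar : (T * lambdaBar m T lam σ U : ℝ) = T * lam + m.eigenvalue U * σ ^ 2 / 2 := by
    rw [lambdaBar]
    field_simp
  have hr : ((lam * T : ℝ≥0) : ℂ) = ((T * lam : ℝ) : ℂ) := by push_cast; ring
  rw [charMatrix_mul hi hM.aemeasurable hY.aemeasurable, hMlaw U,
    charMatrix_compoundPoisson hN hX hind hXN T U hA, hr, smul_mul_assoc, one_mul,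
    exp_smul_exp_sub, hbar]

end Estimates

end Decompounding

open Decompounding

theorem proposition6
    {E : Type*} [NormedAddCommGroup E] [NormedSpace ℝ E] [FiniteDimensional ℝ E]
    {G : Type*} [TopologicalSpace G] [T2Space G] [CompactSpace G] [ConnectedSpace G]
    [ChartedSpace E G] [Group G] [LieGroup 𝓘(ℝ, E) ∞ G]
    [MeasurableSpace G] [BorelSpace G]
    -- normalized Haar measure
    (μ : Measure G) [μ.IsHaarMeasure] [IsProbabilityMeasure μ]
    -- bi-invariant Riemannian metric
    (m : Decompounding.Metric E G) (hm : m.IsBiinvariant)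
    -- compound Poisson process, multiplicative Brownian noise
    {Ω₀ : Type*} [MeasurableSpace Ω₀] (P₀ : Measure Ω₀) [IsProbabilityMeasure P₀]
    (T lam : ℝ≥0) (hT : 0 < T) (hlam : 0 < lam) (σ : ℝ)
    (N : ℝ≥0 → Ω₀ → ℕ) (hN : Decompounding.IsPoissonProcess P₀ lam N)
    (X : ℕ → Ω₀ → G) (hX : ∀ n, Measurable (X n)) (hXindep : iIndepFun X P₀)
    (hXN : IndepFun (fun w (n : ℕ) => X n w) (fun w (t : ℝ≥0) => N t w) P₀)
    -- the common density of the `X n`, in `L²(G, ℝ)`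
    (p : G → ℝ) (hp : MemLp p 2 μ) (hp0 : ∀ᵐ g ∂μ, 0 ≤ p g)
    (hXp : ∀ n, P₀.map (X n) = μ.withDensity fun g => ENNReal.ofReal (p g))
    -- inverse invariance
    (hXinv : IdentDistrib (X 0) (fun w => (X 0 w)⁻¹) P₀ P₀)
    (M : Ω₀ → G) (hM : Measurable M) (hMlaw : Decompounding.IsBrownianNoise m σ P₀ M)
    (hMY : IndepFun M (fun w (t : ℝ≥0) => Decompounding.compoundPoisson N X t w) P₀)
    -- i.i.d. observations of `M Y(T)`
    {Ω : Type*} [MeasurableSpace Ω] (P : Measure Ω) [IsProbabilityMeasure P]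
    (Z : ℕ → Ω → G) (hZindep : iIndepFun Z P)
    (hZ : ∀ n, IdentDistrib (Z n)
      (fun w => M w * Decompounding.compoundPoisson N X T w) P P₀)
    -- a unitary representative of every class, and the cutoffs
    (U : Decompounding.Irr G → Decompounding.UnitaryIrrep G)
    (hU : ∀ δ, Quotient.mk (Decompounding.UnitaryIrrep.setoid G) (U δ) = δ)
    (Γ : ℕ → Finset (Decompounding.Irr G)) (hΓ : Monotone Γ)
    (hΓ_exhaust : ∀ δ, (∃ l, δ ∈ Γ l) ↔ δ ≠ Decompounding.Irr.unit G) :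
    (∀ l n w, MemLp (Decompounding.nonparamEstimate m T lam σ 0 U (Γ l) Z n w) 2 μ) ∧
    ∃ c : ℕ → ℝ,
      (∀ l, TendstoInMeasure P
        (fun n w => (eLpNorm (fun g =>
          Decompounding.nonparamEstimate m T lam σ 0 U (Γ l) Z n w g - (p g : ℂ)) 2 μ).toReal)
        atTop (fun _ => c l)) ∧
      Tendsto c atTop (𝓝 0) := by
  have : IsTopologicalGroup G := topologicalGroup_of_lieGroup 𝓘(ℝ, E) ∞
  have : SecondCountableTopology G := ChartedSpace.secondCountable_of_sigmaCompact E G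
  have hT' : (T : ℂ) ≠ 0 := by exact_mod_cast hT.ne'
  have hlam' : (lam : ℂ) ≠ 0 := by exact_mod_cast hlam.ne'
  let A : ∀ δ, Matrix (Fin (U δ).dim) (Fin (U δ).dim) ℂ := fun δ => charMatrix P₀ (X 0) (U δ)
  let B : ∀ δ, Matrix (Fin (U δ).dim) (Fin (U δ).dim) ℂ := fun δ =>
    ((T * lam : ℝ) : ℂ) • A δ - ((T * lambdaBar m T lam σ (U δ) : ℝ) : ℂ) • 1
  let b : Irr G → ℂ := fun δ => ((lambdaBar m T lam σ (U δ) / lam : ℝ) : ℂ)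
  have hA : ∀ δ n, charMatrix P₀ (X n) (U δ) = A δ := fun δ n =>
    charMatrix_eq_of_identDistrib
      ⟨(hX n).aemeasurable, (hX 0).aemeasurable, (hXp n).trans (hXp 0).symm⟩ (U δ)
  have hB : ∀ δ, (B δ).IsHermitian := fun δ => by
    have hAh : (A δ).IsHermitian := isHermitian_charMatrix hXinv (U δ)
    simp only [B, Matrix.IsHermitian, Matrix.conjTranspose_sub, Matrix.conjTranspose_smul, hAh.eq,
      Matrix.conjTranspose_one, Complex.star_def, Complex.conj_ofReal]
  have hlog : ∀ δ, logEstimate (1 / (T * lam) : ℂ) (b δ) (NormedSpace.exp (B δ)) = A δ :=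
    fun δ => by
      rw [logEstimate_exp _ _ (hB δ)]
      simp only [B, b, smul_sub, smul_smul]
      have h1 : (1 / (T * lam) : ℂ) * ((T * lam : ℝ) : ℂ) = 1 := by
        push_cast
        field_simp
      have h2 : (1 / (T * lam) : ℂ) * ((T * lambdaBar m T lam σ (U δ) : ℝ) : ℂ) =
          ((lambdaBar m T lam σ (U δ) / lam : ℝ) : ℂ) := by
        push_cast
        field_simp
      rw [h1, h2, one_smul, sub_add_cancel]
  have hZchar : ∀ δ, charMatrix P (Z 0) (U δ) = NormedSpace.exp (B δ) := fun δ =>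
    (charMatrix_eq_of_identDistrib (hZ 0) (U δ)).trans
      (charMatrix_noise_mul_compoundPoisson hT hN hX hXindep hXN hM hMlaw hMY (U δ) (hA δ))
  have hpC : MemLp (fun g => (p g : ℂ)) 2 μ := hp.ofReal
  let f : Lp ℂ 2 μ := hpC.toLp _
  -- The summand `1` of the estimates is the Fourier term of the unit representation.
  have hunit : fourierTerm (U (Irr.unit G)) (A (Irr.unit G)) = 1 := by
    have hequiv : UnitaryIrrep.unit G ≈ U (Irr.unit G) := Quotient.exact (hU (Irr.unit G)).symm
    have hA1 : A (Irr.unit G) = 1 := by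
      ext i j
      simp [A, charMatrix_apply, UnitaryIrrep.mat_eq_one_of_equiv_unit hequiv]
    rw [hA1, fourierTerm_one_of_equiv_unit hequiv]
  refine ⟨fun l n w => ?_, fun l => ‖ContinuousMap.toLp 2 μ ℂ
    (1 + ∑ δ ∈ Γ l, fourierTerm (U δ) (A δ)) - f‖, fun l => ?_, ?_⟩
  · rw [nonparamEstimate_eq_fourierSum]
    exact ContinuousMap.memLp (μ := μ) ℂ _
  · have hmean := tendstoInMeasure_empiricalMean hZindep
      (fun n => (hZ n).trans (hZ 0).symm) fun δ : Γ l => U δ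
    simp only [hZchar] at hmean
    -- The norm is written as a function of the empirical means, which are measurable and converge
    -- by the law of large numbers; the set where the spectrum is positive then needs no separate
    -- treatment, as this function is continuous at the limit.
    have h := tendstoInMeasure_comp_of_continuousAt hmean
      (continuousAt_norm_fourierSum μ (fun δ : Γ l => U δ) f (1 / (T * lam)) (fun δ => b δ)
        fun δ => hB δ)
    refine (h.congr (fun n => .of_forall fun w => ?_) (.of_forall fun w => ?_))
    · exact (toReal_eLpNorm_nonparamEstimate_sub μ m T lam σ U (Γ l) Z n w hpC).symm
    · have h1 : ∀ δ : Γ l, logEstimate (1 / (T * lam) : ℂ) (b δ)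
          (hermitianPart (Matrix.of fun i j => NormedSpace.exp (B δ) i j)) = A δ := fun δ =>
        (congrArg (logEstimate _ _) (hermitianPart_of_isHermitian (hB δ).exp)).trans (hlog δ)
      simp only [h1, ← Finset.sum_coe_sort (Γ l)]
  · have h := tendsto_fourierSum μ hU hΓ hΓ_exhaust f A fun δ i j =>
      charMatrix_eq_inner μ (hX 0).aemeasurable hpC hp.aestronglyMeasurable.aemeasurable hp0 (hXp 0)
        (U δ) i j
    rw [hunit] at h
    simpa using (h.sub_const f).norm
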